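/- Manifolds are smooth, Hausdorff, second countable, without boundary and of a fixed finite dimension. A Lie groupoid $G\rightrightarrows M$ consists of manifolds $M$ (objects) and $G$ (arrows), submersions $s,t:G\to M$ (source and target), and smooth maps $m:G\times_M G=\{(g_2,g_1): s(g_2)=t(g_1)\}\to G$ (multiplication), $u:M\to G$ (unit) and $i:G\to G$ (inverse) satisfying the usual groupoid axioms. A map of Lie groupoids $\phi:(G\rightrightarrows M)\to(G'\rightrightarrows M')$ is a pair of smooth maps $G\to G'$ and $M\to M'$, both denoted $\phi$, preserving source, target and multiplication. A commutative square of smooth maps $p_j:P\to M_j$, $f_j:M_j\to N$ ($j=1,2$, $f_1p_1=f_2p_2$) is a *good pullback* if it is a pullback of smooth manifolds, it is a pullback of the underlying topological spaces, and for every $p\in P$ the sequence $0\to T_pP\to T_{p_1(p)}M_1\times T_{p_2(p)}M_2\to T_{f_1(p_1(p))}N$ is exact, where the last map is $(v,w)\mapsto df_1(v)-df_2(w)$. The map $\phi$ is *fully faithful* if the square $$\begin{array}{ccc} G & \xrightarrow{\ \phi\ } & G'\\ {\scriptstyle (t,s)}\downarrow & & \downarrow{\scriptstyle (t',s')}\\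 M\times M & \xrightarrow{\phi\times\phi} & M'\times M'\end{array}$$ is a good pullback, and *essentially surjective* if $G'\times_{M'}M=\{(g',x): s'(g')=\phi(x)\}\to M'$, $(g',x)\mapsto t'(g')$, is a surjective submersion. It is a *weak equivalence* if it is fully faithful and essentially surjective. For $x\in M$ let $G_x=s^{-1}(x)\cap t^{-1}(x)$ be the isotropy Lie group, $O=t(s^{-1}(x))$ the orbit of $x$, with tangent space $T_xO=d_{u(x)}t(\ker d_{u(x)}s)$, and $N_xO=T_xM/T_xO$. The *normal representation* $G_x\curvearrowright N_xO$ lets $g\in G_x$ act by $[d_gs(w)]\mapsto[d_gt(w)]$ for $w\in T_gG$. Let $M/G$ be the set of orbits with the quotient topology. A map $\phi$ of Lie groupoids induces a continuous map $\phi_*:M/G\to M'/G'$ and, for every $x\in M$, a Lie group homomorphism $G_x\to G'_{\phi(x)}$ and a linear map $N_xO\to N_{\phi(x)}O'$, where $O'$ is the orbit of $\phi(x)$. **Theorem.** A map of Lie groupoids $\phi:(G\rightrightarrows M)\to(G'\rightrightarrows M')$ is a weak equivalence if and only if both of the following hold: 1. the induced map $\phi_*:M/G\to M'/G'$ is a homeomorphism;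 2. for every $x\in M$, $\phi$ induces an isomorphism of Lie group representations $(G_x\curvearrowright N_xO)\cong(G'_{\phi(x)}\curvearrowright N_{\phi(x)}O')$; that is, $G_x\to G'_{\phi(x)}$ is an isomorphism of Lie groups and $N_xO\to N_{\phi(x)}O'$ is a linear isomorphism equivariant along it. -/

import Mathlib

open scoped Manifold ContDiff Topology

universe w

noncomputable section

/-! ### Good pullbacks of manifolds -/

section GoodPullback

variable {EP HP P E₁ H₁ M₁ E₂ H₂ M₂ E H M : Type*}
  [NormedAddCommGroup EP] [NormedSpace ℝ EP] [TopologicalSpace HP] [TopologicalSpace P]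
  [ChartedSpace HP P]
  [NormedAddCommGroup E₁] [NormedSpace ℝ E₁] [TopologicalSpace H₁] [TopologicalSpace M₁]
  [ChartedSpace H₁ M₁]
  [NormedAddCommGroup E₂] [NormedSpace ℝ E₂] [TopologicalSpace H₂] [TopologicalSpace M₂]
  [ChartedSpace H₂ M₂]
  [NormedAddCommGroup E] [NormedSpace ℝ E] [TopologicalSpace H] [TopologicalSpace M]
  [ChartedSpace H M]

/-- The set-theoretic fibre product `M₁ ×_M M₂`, as a subset of `M₁ × M₂`. -/
def fiberProduct {M₁ M₂ M : Type*} (f₁ : M₁ → M) (f₂ : M₂ → M) : Set (M₁ × M₂) :=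
  {p | f₁ p.1 = f₂ p.2}

/-- The expected tangent space of the fibre product at a point `(x₁, x₂)` with `f₁ x₁ = f₂ x₂`:
the kernel of `(v, w) ↦ d f₁ v - d f₂ w` on `T_{x₁} M₁ × T_{x₂} M₂`.
(The fibres of `TangentSpace` over equal points are the same vector space, so the equation
makes sense when `f₁ x₁ = f₂ x₂`.) -/
def fiberProductTangent (I₁ : ModelWithCorners ℝ E₁ H₁) (I₂ : ModelWithCorners ℝ E₂ H₂)
    (I : ModelWithCorners ℝ E H) (f₁ : M₁ → M) (f₂ : M₂ → M) (x₁ : M₁) (x₂ : M₂) :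
    Set (TangentSpace I₁ x₁ × TangentSpace I₂ x₂) :=
  {p | (mfderiv I₁ I f₁ x₁ p.1 : E) = mfderiv I₂ I f₂ x₂ p.2}

/-- The commutative square of smooth maps with sides `p₁ : P → M₁`, `p₂ : P → M₂`, `f₁ : M₁ → M`,
`f₂ : M₂ → M` is a good pullback of manifolds: it is a pullback in the category of (second
countable, Hausdorff) smooth manifolds, it is a pullback of topological spaces, and it induces
pullbacks of tangent spaces, i.e. `0 → T P → T M₁ × T M₂ → T M` is exact. -/
structure IsGoodPullback (IP : ModelWithCorners ℝ EP HP) (I₁ : ModelWithCorners ℝ E₁ H₁)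
    (I₂ : ModelWithCorners ℝ E₂ H₂) (I : ModelWithCorners ℝ E H)
    (p₁ : P → M₁) (p₂ : P → M₂) (f₁ : M₁ → M) (f₂ : M₂ → M) : Prop where
  smooth_p₁ : ContMDiff IP I₁ ∞ p₁
  smooth_p₂ : ContMDiff IP I₂ ∞ p₂
  smooth_f₁ : ContMDiff I₁ I ∞ f₁
  smooth_f₂ : ContMDiff I₂ I ∞ f₂
  comm : ∀ p, f₁ (p₁ p) = f₂ (p₂ p)
  /-- the universal property among smooth manifolds -/
  universal : ∀ (d : ℕ) (Z : Type w) [TopologicalSpace Z]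
    [ChartedSpace (EuclideanSpace ℝ (Fin d)) Z] [IsManifold (𝓡 d) ∞ Z] [T2Space Z]
    [SecondCountableTopology Z] (a : Z → M₁) (b : Z → M₂),
    ContMDiff (𝓡 d) I₁ ∞ a → ContMDiff (𝓡 d) I₂ ∞ b → (∀ z, f₁ (a z) = f₂ (b z)) →
      ∃! c : Z → P, ContMDiff (𝓡 d) IP ∞ c ∧ (∀ z, p₁ (c z) = a z) ∧ (∀ z, p₂ (c z) = b z)
  /-- `P` is the topological fibre product -/
  topological : IsHomeomorph (fun p ↦ (⟨(p₁ p, p₂ p), comm p⟩ : fiberProduct f₁ f₂))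
  /-- exactness of `0 → T P → T M₁ × T M₂ → T M` -/
  tangent : ∀ p, Set.BijOn (fun v ↦ (mfderiv IP I₁ p₁ p v, mfderiv IP I₂ p₂ p v))
    Set.univ (fiberProductTangent I₁ I₂ I f₁ f₂ (p₁ p) (p₂ p))

/-- The map `f : M₁ → M₂` restricts to a diffeomorphism from the subset `S` onto the subset `T`:
it is a bijection `S → T`, smooth on `S`, with inverse smooth on `T`. For embedded submanifolds
`S` and `T` this is the usual notion of a diffeomorphism. -/
def RestrictsToDiffeo (I₁ : ModelWithCorners ℝ E₁ H₁) (I₂ : ModelWithCorners ℝ E₂ H₂)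
    (f : M₁ → M₂) (S : Set M₁) (T : Set M₂) : Prop :=
  Set.BijOn f S T ∧ ContMDiffOn I₁ I₂ ∞ f S ∧
    ∃ h : M₂ → M₁, Set.InvOn h f S T ∧ Set.MapsTo h T S ∧ ContMDiffOn I₂ I₁ ∞ h T

end GoodPullback

/-! ### Curves and submersions -/

section Curves

set_option linter.unusedSectionVars false

/-- Chain rule along a curve. -/
theorem curve_comp {n k : ℕ} {G N : Type*}
    [TopologicalSpace G] [ChartedSpace (EuclideanSpace ℝ (Fin k)) G]
    [TopologicalSpace N] [ChartedSpace (EuclideanSpace ℝ (Fin n)) N]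
    {c : ℝ → G} {f : G → N} {τ : ℝ} {g : G} (hc0 : c τ = g)
    (hc : MDifferentiableAt 𝓘(ℝ, ℝ) (𝓡 k) c τ) (hf : MDifferentiableAt (𝓡 k) (𝓡 n) f g) :
    (mfderiv 𝓘(ℝ, ℝ) (𝓡 n) (fun r ↦ f (c r)) τ (1 : ℝ) : EuclideanSpace ℝ (Fin n)) =
      mfderiv (𝓡 k) (𝓡 n) f g (mfderiv 𝓘(ℝ, ℝ) (𝓡 k) c τ (1 : ℝ)) := by
  subst hc0
  have := mfderiv_comp (I := 𝓘(ℝ, ℝ)) (I' := 𝓡 k) (I'' := 𝓡 n) τ hf hc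
  have h2 : (fun r ↦ f (c r)) = f ∘ c := rfl
  rw [h2, this]
  rfl

variable {m k : ℕ} {M G : Type*}
  [TopologicalSpace M] [ChartedSpace (EuclideanSpace ℝ (Fin m)) M] [IsManifold (𝓡 m) ∞ M]
  [TopologicalSpace G] [ChartedSpace (EuclideanSpace ℝ (Fin k)) G] [IsManifold (𝓡 k) ∞ G]

/-- A curve which in a chart around `g` has velocity `mfderiv χ g w` has velocity `w`. -/
theorem velocity_of_chart {χ : OpenPartialHomeomorph G (EuclideanSpace ℝ (Fin k))}
    (hχ : χ ∈ IsManifold.maximalAtlas (𝓡 k) ∞ G) {g : G} (hg : g ∈ χ.source)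
    {y : ℝ → EuclideanSpace ℝ (Fin k)} (hy : ContDiffAt ℝ ∞ y 0) (hy0 : y 0 = χ g)
    (w : EuclideanSpace ℝ (Fin k))
    (hw : deriv y 0 = (mfderiv (𝓡 k) (𝓡 k) χ g w : EuclideanSpace ℝ (Fin k))) :
    ContMDiffAt 𝓘(ℝ, ℝ) (𝓡 k) ∞ (fun τ ↦ χ.symm (y τ)) 0 ∧ χ.symm (y 0) = g ∧
      (mfderiv 𝓘(ℝ, ℝ) (𝓡 k) (fun τ ↦ χ.symm (y τ)) 0 (1 : ℝ) : EuclideanSpace ℝ (Fin k)) = w := by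
  have hx0 : χ.symm (y 0) = g := by rw [hy0, χ.left_inv hg]
  have hyM : ContMDiffAt 𝓘(ℝ, ℝ) (𝓡 k) ∞ y 0 := hy.contMDiffAt
  have hsymm : ContMDiffAt (𝓡 k) (𝓡 k) ∞ χ.symm (χ g) :=
    contMDiffAt_symm_of_mem_maximalAtlas hχ (χ.map_source hg)
  have hsm : ContMDiffAt 𝓘(ℝ, ℝ) (𝓡 k) ∞ (fun τ ↦ χ.symm (y τ)) 0 :=
    ContMDiffAt.comp (0 : ℝ) (hy0 ▸ hsymm) hyM
  have hχd : MDifferentiableAt (𝓡 k) (𝓡 k) χ g :=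
    (contMDiffAt_of_mem_maximalAtlas hχ hg).mdifferentiableAt (by simp)
  have h1 := curve_comp (f := χ.symm) (c := y) (τ := 0) (g := χ g) hy0
    (hyM.mdifferentiableAt (by simp)) (hsymm.mdifferentiableAt (by simp))
  refine ⟨hsm, hx0, ?_⟩
  have h2 : (mfderiv 𝓘(ℝ, ℝ) (𝓡 k) y 0 (1 : ℝ) : EuclideanSpace ℝ (Fin k)) =
      mfderiv (𝓡 k) (𝓡 k) χ g w := by
    rw [← hw, mfderiv_eq_fderiv, ← fderiv_apply_one_eq_deriv]
    rfl
  have h3 : mfderiv (𝓡 k) (𝓡 k) (χ.symm ∘ χ) g =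
      (mfderiv (𝓡 k) (𝓡 k) χ.symm (χ g)).comp (mfderiv (𝓡 k) (𝓡 k) χ g) :=
    mfderiv_comp g (hsymm.mdifferentiableAt (by simp)) hχd
  have h4 : mfderiv (𝓡 k) (𝓡 k) (χ.symm ∘ χ) g = mfderiv (𝓡 k) (𝓡 k) (id : G → G) g := by
    apply Filter.EventuallyEq.mfderiv_eq
    filter_upwards [χ.open_source.mem_nhds hg] with z hz
    simp [χ.left_inv hz]
  have h5 : (mfderiv (𝓡 k) (𝓡 k) χ.symm (χ g) (mfderiv (𝓡 k) (𝓡 k) χ g w) :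
      EuclideanSpace ℝ (Fin k)) = w := by
    have := congrArg (fun L : EuclideanSpace ℝ (Fin k) →L[ℝ] EuclideanSpace ℝ (Fin k) ↦ L w)
      (h3.symm.trans h4)
    refine Eq.trans this ?_
    simp only [mfderiv_id]
    rfl
  refine h1.trans (Eq.trans ?_ h5)
  exact congrArg (fun u : EuclideanSpace ℝ (Fin k) ↦
    (mfderiv (𝓡 k) (𝓡 k) χ.symm (χ g) u : EuclideanSpace ℝ (Fin k))) h2

/-- Every tangent vector is the velocity of a smooth curve. -/
theorem exists_curve (g : G) (w : EuclideanSpace ℝ (Fin k)) :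
    ∃ c : ℝ → G, ContMDiffAt 𝓘(ℝ, ℝ) (𝓡 k) ∞ c 0 ∧ c 0 = g ∧
      (mfderiv 𝓘(ℝ, ℝ) (𝓡 k) c 0 (1 : ℝ) : EuclideanSpace ℝ (Fin k)) = w := by
  set χ := chartAt (EuclideanSpace ℝ (Fin k)) g
  set d : EuclideanSpace ℝ (Fin k) := mfderiv (𝓡 k) (𝓡 k) χ g w with hd
  have := velocity_of_chart (χ := χ) (IsManifold.chart_mem_maximalAtlas g)
    (mem_chart_source _ g) (y := fun τ ↦ χ g + τ • d) (by fun_prop) (by simp) w (by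
      have : HasDerivAt (fun τ : ℝ ↦ χ g + τ • d) ((1 : ℝ) • d) 0 :=
        ((hasDerivAt_id (0 : ℝ)).smul_const d).const_add (χ g)
      rw [this.deriv, one_smul])
  exact ⟨_, this⟩

/-- The local form of a submersion: curves can be lifted with prescribed initial velocity. -/
theorem Manifold.IsSubmersionAt.exists_lift {s : G → M} {g : G}
    (hs : Manifold.IsSubmersionAt (𝓡 k) (𝓡 m) ∞ s g) {γ : ℝ → M}
    (hγ : ContMDiffAt 𝓘(ℝ, ℝ) (𝓡 m) ∞ γ 0) (h0 : γ 0 = s g) (w : EuclideanSpace ℝ (Fin k))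
    (hw : (mfderiv (𝓡 k) (𝓡 m) s g w : EuclideanSpace ℝ (Fin m)) =
      mfderiv 𝓘(ℝ, ℝ) (𝓡 m) γ 0 (1 : ℝ)) :
    ∃ c : ℝ → G, ContMDiffAt 𝓘(ℝ, ℝ) (𝓡 k) ∞ c 0 ∧ c 0 = g ∧ (∀ᶠ τ in 𝓝 0, s (c τ) = γ τ) ∧
      (mfderiv 𝓘(ℝ, ℝ) (𝓡 k) c 0 (1 : ℝ) : EuclideanSpace ℝ (Fin k)) = w := by
  set χ := hs.domChart
  set ψ := hs.codChart
  set e := hs.equiv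
  have hχ : χ ∈ IsManifold.maximalAtlas (𝓡 k) ∞ G := hs.domChart_mem_maximalAtlas
  have hψ : ψ ∈ IsManifold.maximalAtlas (𝓡 m) ∞ M := hs.codChart_mem_maximalAtlas
  have hgχ : g ∈ χ.source := hs.mem_domChart_source
  have hgψ : s g ∈ ψ.source := hs.mem_codChart_source
  have hloc : ∀ z ∈ χ.source, ψ (s z) = (e (χ z)).1 := by
    intro z hz
    have hz' : χ z ∈ (hs.domChart.extend (𝓡 k)).target := by simpa using χ.map_source hz
    have := hs.writtenInCharts hz'
    simpa [χ, χ.left_inv hz] using this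
  set d : EuclideanSpace ℝ (Fin k) := mfderiv (𝓡 k) (𝓡 k) χ g w with hd
  have hχd : MDifferentiableAt (𝓡 k) (𝓡 k) χ g :=
    (contMDiffAt_of_mem_maximalAtlas hχ hgχ).mdifferentiableAt (by simp)
  have hψs : ContMDiffAt (𝓡 m) (𝓡 m) ∞ ψ (s g) := contMDiffAt_of_mem_maximalAtlas hψ hgψ
  have hψγ : ContMDiffAt 𝓘(ℝ, ℝ) (𝓡 m) ∞ (fun τ ↦ ψ (γ τ)) 0 :=
    ContMDiffAt.comp (0 : ℝ) (h0.symm ▸ hψs) hγ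
  have hψγ' : ContDiffAt ℝ ∞ (fun τ ↦ ψ (γ τ)) 0 := hψγ.contDiffAt
  -- the velocity of `ψ ∘ γ` is the first component of `e d`
  have hvel : deriv (fun τ ↦ ψ (γ τ)) 0 = (e d).1 := by
    have h1 := curve_comp (f := ψ) (c := γ) (τ := 0) (g := s g) h0
      (hγ.mdifferentiableAt (by simp)) (hψs.mdifferentiableAt (by simp))
    rw [mfderiv_eq_fderiv] at h1
    rw [← fderiv_apply_one_eq_deriv]
    refine h1.trans ?_
    rw [← hw]
    have h2 := mfderiv_comp (I := 𝓡 k) (I' := 𝓡 m) (I'' := 𝓡 m) g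
      (hψs.mdifferentiableAt (by simp)) (hs.contMDiffAt.mdifferentiableAt (by simp))
    have hfst : ContDiff ℝ ∞ (fun v : EuclideanSpace ℝ (Fin k) ↦ (e v).1) := by fun_prop
    have h3 := mfderiv_comp (I := 𝓡 k) (I' := 𝓡 k) (I'' := 𝓡 m) g
      (g := fun v : EuclideanSpace ℝ (Fin k) ↦ (e v).1) (f := χ)
      (hfst.contMDiff.mdifferentiableAt (by simp)) hχd
    have h4 : mfderiv (𝓡 k) (𝓡 m) (ψ ∘ s) g =
        mfderiv (𝓡 k) (𝓡 m) ((fun v : EuclideanSpace ℝ (Fin k) ↦ (e v).1) ∘ χ) g := by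
      apply Filter.EventuallyEq.mfderiv_eq
      filter_upwards [χ.open_source.mem_nhds hgχ] with z hz
      exact hloc z hz
    have h5 := congrArg (fun L : EuclideanSpace ℝ (Fin k) →L[ℝ] EuclideanSpace ℝ (Fin m) ↦ L w)
      ((h2.symm.trans h4).trans h3)
    refine Eq.trans h5 ?_
    have h6 : HasFDerivAt (fun v : EuclideanSpace ℝ (Fin k) ↦ (e v).1)
        ((ContinuousLinearMap.fst ℝ (EuclideanSpace ℝ (Fin m)) hs.complement).comp
          (e : EuclideanSpace ℝ (Fin k) →L[ℝ] EuclideanSpace ℝ (Fin m) × hs.complement)) (χ g) :=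
      ((ContinuousLinearMap.fst ℝ (EuclideanSpace ℝ (Fin m)) hs.complement).comp
          (e : EuclideanSpace ℝ (Fin k) →L[ℝ]
            EuclideanSpace ℝ (Fin m) × hs.complement)).hasFDerivAt
    have h7 := h6.hasMFDerivAt.mfderiv
    rw [h7]
    rfl
  set y : ℝ → EuclideanSpace ℝ (Fin k) :=
    fun τ ↦ e.symm (ψ (γ τ), (e (χ g)).2 + τ • (e d).2) with hy
  have hy0 : y 0 = χ g := by
    simp only [hy, h0, zero_smul, add_zero, hloc g hgχ, Prod.mk.eta, e.symm_apply_apply]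
  have hysm : ContDiffAt ℝ ∞ y 0 := by
    apply e.symm.contDiff.contDiffAt.comp
    exact hψγ'.prodMk (by fun_prop)
  have hyd : deriv y 0 = d := by
    have h1 : HasDerivAt (fun τ ↦ ψ (γ τ)) (e d).1 0 := by
      rw [← hvel]
      exact (hψγ'.differentiableAt (by simp)).hasDerivAt
    have h2 : HasDerivAt (fun τ : ℝ ↦ (e (χ g)).2 + τ • (e d).2) (e d).2 0 := by
      simpa using ((hasDerivAt_id (0 : ℝ)).smul_const (e d).2).const_add (e (χ g)).2
    have h3 := (e.symm.hasFDerivAt (x := (ψ (γ 0), (e (χ g)).2 + (0 : ℝ) • (e d).2))).comp_hasDerivAt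
      (0 : ℝ) (h1.prodMk h2)
    have h4 : HasDerivAt y (e.symm ((e d).1, (e d).2)) 0 := h3
    rw [h4.deriv]
    simp
  obtain ⟨hc, hc0, hcd⟩ := velocity_of_chart hχ hgχ hysm hy0 w hyd
  refine ⟨_, hc, hc0, ?_, hcd⟩
  have ht : ∀ᶠ τ in 𝓝 (0 : ℝ), y τ ∈ χ.target :=
    hysm.continuousAt.eventually_mem (χ.open_target.mem_nhds (hy0 ▸ χ.map_source hgχ))
  have ht' : ∀ᶠ τ in 𝓝 (0 : ℝ), γ τ ∈ ψ.source :=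
    hγ.continuousAt.eventually_mem (ψ.open_source.mem_nhds (h0 ▸ hgψ))
  filter_upwards [ht, ht'] with τ h1 h2
  have h3 : χ.symm (y τ) ∈ χ.source := χ.map_target h1
  apply ψ.injOn (hs.source_subset_preimage_source h3) h2
  rw [hloc _ h3, χ.right_inv h1]
  simp [hy]

/-- The differential of a submersion is surjective. -/
theorem Manifold.IsSubmersionAt.exists_mfderiv_eq {s : G → M} {g : G}
    (hs : Manifold.IsSubmersionAt (𝓡 k) (𝓡 m) ∞ s g) (v : EuclideanSpace ℝ (Fin m)) :
    ∃ w : EuclideanSpace ℝ (Fin k),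
      (mfderiv (𝓡 k) (𝓡 m) s g w : EuclideanSpace ℝ (Fin m)) = v := by
  set χ := hs.domChart
  set ψ := hs.codChart
  set e := hs.equiv
  have hχ : χ ∈ IsManifold.maximalAtlas (𝓡 k) ∞ G := hs.domChart_mem_maximalAtlas
  have hψ : ψ ∈ IsManifold.maximalAtlas (𝓡 m) ∞ M := hs.codChart_mem_maximalAtlas
  have hgχ : g ∈ χ.source := hs.mem_domChart_source
  have hgψ : s g ∈ ψ.source := hs.mem_codChart_source
  have hloc : ∀ z ∈ χ.source, ψ (s z) = (e (χ z)).1 := by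
    intro z hz
    have hz' : χ z ∈ (hs.domChart.extend (𝓡 k)).target := by simpa using χ.map_source hz
    have := hs.writtenInCharts hz'
    simpa [χ, χ.left_inv hz] using this
  obtain ⟨γ, hγ, hγ0, hγv⟩ := exists_curve (s g) v
  have hψs : ContMDiffAt (𝓡 m) (𝓡 m) ∞ ψ (s g) := contMDiffAt_of_mem_maximalAtlas hψ hgψ
  have hψγ : ContMDiffAt 𝓘(ℝ, ℝ) (𝓡 m) ∞ (fun τ ↦ ψ (γ τ)) 0 :=
    ContMDiffAt.comp (0 : ℝ) (hγ0.symm ▸ hψs) hγ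
  have hψγ' : ContDiffAt ℝ ∞ (fun τ ↦ ψ (γ τ)) 0 := hψγ.contDiffAt
  set y : ℝ → EuclideanSpace ℝ (Fin k) := fun τ ↦ e.symm (ψ (γ τ), (e (χ g)).2) with hy
  have hy0 : y 0 = χ g := by
    simp only [hy, hγ0, hloc g hgχ, Prod.mk.eta, e.symm_apply_apply]
  have hysm : ContDiffAt ℝ ∞ y 0 := by
    apply e.symm.contDiff.contDiffAt.comp
    exact hψγ'.prodMk (by fun_prop)
  have hsymm : ContMDiffAt (𝓡 k) (𝓡 k) ∞ χ.symm (χ g) :=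
    contMDiffAt_symm_of_mem_maximalAtlas hχ (χ.map_source hgχ)
  have hyM : ContMDiffAt 𝓘(ℝ, ℝ) (𝓡 k) ∞ y 0 := hysm.contMDiffAt
  have hsm : ContMDiffAt 𝓘(ℝ, ℝ) (𝓡 k) ∞ (fun τ ↦ χ.symm (y τ)) 0 :=
    ContMDiffAt.comp (0 : ℝ) (hy0 ▸ hsymm) hyM
  have hx0 : χ.symm (y 0) = g := by rw [hy0, χ.left_inv hgχ]
  refine ⟨mfderiv 𝓘(ℝ, ℝ) (𝓡 k) (fun τ ↦ χ.symm (y τ)) 0 (1 : ℝ), ?_⟩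
  rw [← curve_comp (f := s) (c := fun τ ↦ χ.symm (y τ)) hx0 (hsm.mdifferentiableAt (by simp))
    (hs.contMDiffAt.mdifferentiableAt (by simp)), ← hγv]
  have ht : ∀ᶠ τ in 𝓝 (0 : ℝ), y τ ∈ χ.target :=
    hysm.continuousAt.eventually_mem (χ.open_target.mem_nhds (hy0 ▸ χ.map_source hgχ))
  have ht' : ∀ᶠ τ in 𝓝 (0 : ℝ), γ τ ∈ ψ.source :=
    hγ.continuousAt.eventually_mem (ψ.open_source.mem_nhds (hγ0 ▸ hgψ))
  have hev : (fun τ ↦ s (χ.symm (y τ))) =ᶠ[𝓝 0] γ := by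
    filter_upwards [ht, ht'] with τ h1 h2
    have h3 : χ.symm (y τ) ∈ χ.source := χ.map_target h1
    apply ψ.injOn (hs.source_subset_preimage_source h3) h2
    rw [hloc _ h3, χ.right_inv h1]
    simp [hy]
  exact congrArg (fun L : ℝ →L[ℝ] EuclideanSpace ℝ (Fin m) ↦ L 1) hev.mfderiv_eq

end Curves

/-! ### Lie groupoids -/

/-- A Lie groupoid `G ⇉ M`, where `M` is an `m`-dimensional manifold of objects and `G` is a
`k`-dimensional manifold of arrows. The product `mul g h` is meaningful only for composable
arrows `src g = tgt h` (first `h`, then `g`): the axioms say nothing about other pairs, and no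
notion below depends on the values there. Smoothness of the multiplication is smoothness on the
submanifold of composable pairs. -/
structure LieGroupoid (m k : ℕ) (M G : Type*)
    [TopologicalSpace M] [ChartedSpace (EuclideanSpace ℝ (Fin m)) M]
    [TopologicalSpace G] [ChartedSpace (EuclideanSpace ℝ (Fin k)) G] where
  src : G → M
  tgt : G → M
  one : M → G
  inv : G → G
  mul : G → G → G
  src_submersion : Manifold.IsSubmersion (𝓡 k) (𝓡 m) ∞ src
  tgt_submersion : Manifold.IsSubmersion (𝓡 k) (𝓡 m) ∞ tgt
  one_smooth : ContMDiff (𝓡 m) (𝓡 k) ∞ one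
  inv_smooth : ContMDiff (𝓡 k) (𝓡 k) ∞ inv
  mul_smooth : ContMDiffOn ((𝓡 k).prod (𝓡 k)) (𝓡 k) ∞ (fun p : G × G ↦ mul p.1 p.2)
    {p | src p.1 = tgt p.2}
  src_one : ∀ x, src (one x) = x
  tgt_one : ∀ x, tgt (one x) = x
  src_inv : ∀ g, src (inv g) = tgt g
  tgt_inv : ∀ g, tgt (inv g) = src g
  src_mul : ∀ g h, src g = tgt h → src (mul g h) = src h
  tgt_mul : ∀ g h, src g = tgt h → tgt (mul g h) = tgt g
  mul_assoc : ∀ g h l, src g = tgt h → src h = tgt l → mul (mul g h) l = mul g (mul h l)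
  mul_one : ∀ g, mul g (one (src g)) = g
  one_mul : ∀ g, mul (one (tgt g)) g = g
  mul_inv : ∀ g, mul g (inv g) = one (tgt g)
  inv_mul : ∀ g, mul (inv g) g = one (src g)

namespace LieGroupoid

set_option linter.unusedSectionVars false

variable {m k : ℕ} {M G : Type*}
  [TopologicalSpace M] [ChartedSpace (EuclideanSpace ℝ (Fin m)) M]
  [TopologicalSpace G] [ChartedSpace (EuclideanSpace ℝ (Fin k)) G]
  (𝒢 : LieGroupoid m k M G)

/-- The anchor `ρ = (t, s) : G → M × M`. -/
def anchor (g : G) : M × M := (𝒢.tgt g, 𝒢.src g)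

/-- Two objects are in the same orbit if there is an arrow between them. -/
def orbitRel : Setoid M where
  r x y := ∃ g, 𝒢.src g = x ∧ 𝒢.tgt g = y
  iseqv :=
    { refl := fun x ↦ ⟨𝒢.one x, 𝒢.src_one x, 𝒢.tgt_one x⟩
      symm := by
        rintro x y ⟨g, rfl, rfl⟩
        exact ⟨𝒢.inv g, 𝒢.src_inv g, 𝒢.tgt_inv g⟩
      trans := by
        rintro x y z ⟨g, rfl, rfl⟩ ⟨h, hh, rfl⟩
        exact ⟨𝒢.mul h g, 𝒢.src_mul h g hh, 𝒢.tgt_mul h g hh⟩ }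

/-- The orbit space `M/G`, with the quotient topology. -/
abbrev OrbitSpace : Type _ := Quotient 𝒢.orbitRel

/-- The isotropy group `G_x`, as a subset of `G`. -/
def isotropySet (x : M) : Set G := {g | 𝒢.src g = x ∧ 𝒢.tgt g = x}

/-- The isotropy group `G_x`, as a type. -/
abbrev Isotropy (x : M) : Type _ := 𝒢.isotropySet x

instance (x : M) : Group (𝒢.Isotropy x) where
  mul g h := ⟨𝒢.mul g h, by
    have e : 𝒢.src g.1 = 𝒢.tgt h.1 := g.2.1.trans h.2.2.symm
    exact ⟨(𝒢.src_mul _ _ e).trans h.2.1, (𝒢.tgt_mul _ _ e).trans g.2.2⟩⟩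
  one := ⟨𝒢.one x, 𝒢.src_one x, 𝒢.tgt_one x⟩
  inv g := ⟨𝒢.inv g, (𝒢.src_inv _).trans g.2.2, (𝒢.tgt_inv _).trans g.2.1⟩
  mul_assoc g h l := Subtype.ext
    (𝒢.mul_assoc g h l (g.2.1.trans h.2.2.symm) (h.2.1.trans l.2.2.symm))
  one_mul := by
    rintro ⟨g, hs, rfl⟩
    exact Subtype.ext (𝒢.one_mul g)
  mul_one := by
    rintro ⟨g, rfl, ht⟩
    exact Subtype.ext (𝒢.mul_one g)
  inv_mul_cancel := by
    rintro ⟨g, rfl, ht⟩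
    exact Subtype.ext (𝒢.inv_mul g)

theorem coe_mul {x : M} (g h : 𝒢.Isotropy x) : ((g * h : 𝒢.Isotropy x) : G) = 𝒢.mul g h := rfl

theorem coe_one (x : M) : ((1 : 𝒢.Isotropy x) : G) = 𝒢.one x := rfl

/-- The differential of the source map at `g`, from `T_g G` to `T_{s(g)} M`; both tangent spaces
are, by definition of `TangentSpace`, the model spaces. -/
def dsrc (g : G) : EuclideanSpace ℝ (Fin k) →ₗ[ℝ] EuclideanSpace ℝ (Fin m) :=
  ContinuousLinearMap.toLinearMap (mfderiv (𝓡 k) (𝓡 m) 𝒢.src g :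
    EuclideanSpace ℝ (Fin k) →L[ℝ] EuclideanSpace ℝ (Fin m))

/-- The differential of the target map at `g`, from `T_g G` to `T_{t(g)} M`. -/
def dtgt (g : G) : EuclideanSpace ℝ (Fin k) →ₗ[ℝ] EuclideanSpace ℝ (Fin m) :=
  ContinuousLinearMap.toLinearMap (mfderiv (𝓡 k) (𝓡 m) 𝒢.tgt g :
    EuclideanSpace ℝ (Fin k) →L[ℝ] EuclideanSpace ℝ (Fin m))

/-- The tangent space `T_x O` at `x` of the orbit `O` through `x`. The manifold structure of `O`
is that of the quotient `s⁻¹(x) / G_x`, for which `t : s⁻¹(x) → O` is a submersion; hence `T_x O`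
is the image under `dt` of the tangent space `ker ds` of the source fibre at `1_x`. -/
def orbitTangent (x : M) : Submodule ℝ (TangentSpace (𝓡 m) x) :=
  (LinearMap.ker (𝒢.dsrc (𝒢.one x))).map (𝒢.dtgt (𝒢.one x))

/-- The normal space `N_x O = T_x M / T_x O` of the orbit `O` through `x`. -/
abbrev NormalSpace (x : M) : Type := TangentSpace (𝓡 m) x ⧸ 𝒢.orbitTangent x

theorem src_contMDiffAt (g : G) : ContMDiffAt (𝓡 k) (𝓡 m) ∞ 𝒢.src g :=
  (𝒢.src_submersion.isSubmersionAt g).contMDiffAt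

theorem tgt_contMDiffAt (g : G) : ContMDiffAt (𝓡 k) (𝓡 m) ∞ 𝒢.tgt g :=
  (𝒢.tgt_submersion.isSubmersionAt g).contMDiffAt

variable [IsManifold (𝓡 m) ∞ M] [IsManifold (𝓡 k) ∞ G]

theorem dsrc_surjective (g : G) : Function.Surjective (𝒢.dsrc g) := fun v ↦
  (𝒢.src_submersion.isSubmersionAt g).exists_mfderiv_eq v

/-- Multiplication on composable tangent vectors, seen through source and target. -/
theorem exists_tangent_mul {g h : G} (hgh : 𝒢.src g = 𝒢.tgt h)
    (v w : EuclideanSpace ℝ (Fin k)) (hvw : 𝒢.dsrc g v = 𝒢.dtgt h w) :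
    ∃ u, 𝒢.dsrc (𝒢.mul g h) u = 𝒢.dsrc h w ∧ 𝒢.dtgt (𝒢.mul g h) u = 𝒢.dtgt g v := by
  obtain ⟨c, hc, hc0, hcw⟩ := exists_curve h w
  have htc : ContMDiffAt 𝓘(ℝ, ℝ) (𝓡 m) ∞ (fun τ ↦ 𝒢.tgt (c τ)) 0 :=
    ContMDiffAt.comp (0 : ℝ) (𝒢.tgt_contMDiffAt (c 0)) hc
  have hcd := hc.mdifferentiableAt (by simp : (∞ : WithTop ℕ∞) ≠ 0)
  obtain ⟨b, hb, hb0, hbc, hbv⟩ := (𝒢.src_submersion.isSubmersionAt g).exists_lift htc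
      (by simp only [hc0]; exact hgh.symm) v (by
      refine Eq.trans hvw ?_
      refine Eq.trans ?_
        (curve_comp hc0 hcd ((𝒢.tgt_contMDiffAt h).mdifferentiableAt (by simp))).symm
      exact congrArg (fun w' : EuclideanSpace ℝ (Fin k) ↦ 𝒢.dtgt h w') hcw.symm)
  have hbd := hb.mdifferentiableAt (by simp : (∞ : WithTop ℕ∞) ≠ 0)
  set a : ℝ → G := fun τ ↦ 𝒢.mul (b τ) (c τ) with ha
  have ha0 : a 0 = 𝒢.mul g h := by simp only [ha, hb0, hc0]
  have hasm : ContMDiffAt 𝓘(ℝ, ℝ) (𝓡 k) ∞ a 0 := by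
    have h1 := 𝒢.mul_smooth (b 0, c 0) (by simp [hb0, hc0, hgh])
    have h2 : ContMDiffAt 𝓘(ℝ, ℝ) ((𝓡 k).prod (𝓡 k)) ∞ (fun τ ↦ (b τ, c τ)) 0 := hb.prodMk hc
    have h3 := ContMDiffWithinAt.comp (s := {τ | 𝒢.src (b τ) = 𝒢.tgt (c τ)}) (0 : ℝ) h1
      h2.contMDiffWithinAt (fun τ hτ ↦ hτ)
    exact h3.contMDiffAt hbc
  have had := hasm.mdifferentiableAt (by simp : (∞ : WithTop ℕ∞) ≠ 0)
  refine ⟨mfderiv 𝓘(ℝ, ℝ) (𝓡 k) a 0 (1 : ℝ), ?_, ?_⟩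
  · have h1 := curve_comp ha0 had ((𝒢.src_contMDiffAt (𝒢.mul g h)).mdifferentiableAt (by simp))
    have h2 := curve_comp hc0 hcd ((𝒢.src_contMDiffAt h).mdifferentiableAt (by simp))
    have h3 : (fun τ ↦ 𝒢.src (a τ)) =ᶠ[𝓝 0] fun τ ↦ 𝒢.src (c τ) := by
      filter_upwards [hbc] with τ hτ
      exact 𝒢.src_mul _ _ hτ
    have h4 := congrArg (fun L : ℝ →L[ℝ] EuclideanSpace ℝ (Fin m) ↦ L 1)
      (h3.mfderiv_eq (I := 𝓘(ℝ, ℝ)) (I' := 𝓡 m))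
    refine (h1.symm.trans (h4.trans h2)).trans ?_
    exact congrArg (fun w' : EuclideanSpace ℝ (Fin k) ↦ 𝒢.dsrc h w') hcw
  · have h1 := curve_comp ha0 had ((𝒢.tgt_contMDiffAt (𝒢.mul g h)).mdifferentiableAt (by simp))
    have h2 := curve_comp hb0 hbd ((𝒢.tgt_contMDiffAt g).mdifferentiableAt (by simp))
    have h3 : (fun τ ↦ 𝒢.tgt (a τ)) =ᶠ[𝓝 0] fun τ ↦ 𝒢.tgt (b τ) := by
      filter_upwards [hbc] with τ hτ
      exact 𝒢.tgt_mul _ _ hτ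
    have h4 := congrArg (fun L : ℝ →L[ℝ] EuclideanSpace ℝ (Fin m) ↦ L 1)
      (h3.mfderiv_eq (I := 𝓘(ℝ, ℝ)) (I' := 𝓡 m))
    refine (h1.symm.trans (h4.trans h2)).trans ?_
    exact congrArg (fun w' : EuclideanSpace ℝ (Fin k) ↦ 𝒢.dtgt g w') hbv

/-- `dt` maps the tangent space of a source fibre to the tangent space of the orbit. -/
theorem dtgt_mem_orbitTangent {g : G} {y : M} (hy : 𝒢.tgt g = y) {w : EuclideanSpace ℝ (Fin k)}
    (hw : 𝒢.dsrc g w = 0) : 𝒢.dtgt g w ∈ 𝒢.orbitTangent y := by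
  subst hy
  obtain ⟨u, hu1, hu2⟩ := 𝒢.exists_tangent_mul (𝒢.tgt_inv g).symm w 0 (by simp [hw])
  rw [𝒢.mul_inv] at hu1 hu2
  exact ⟨u, by simpa using hu1, hu2⟩

theorem exists_inv_tangent (g : G) (u : EuclideanSpace ℝ (Fin k)) :
    ∃ u', 𝒢.dsrc (𝒢.inv g) u' = 𝒢.dtgt g u ∧ 𝒢.dtgt (𝒢.inv g) u' = 𝒢.dsrc g u := by
  have hi : MDifferentiableAt (𝓡 k) (𝓡 k) 𝒢.inv g := 𝒢.inv_smooth.mdifferentiableAt (by simp)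
  refine ⟨mfderiv (𝓡 k) (𝓡 k) 𝒢.inv g u, ?_, ?_⟩
  · have h1 := mfderiv_comp g
      ((𝒢.src_contMDiffAt (𝒢.inv g)).mdifferentiableAt (by simp)) hi
    have h2 : 𝒢.src ∘ 𝒢.inv = 𝒢.tgt := funext 𝒢.src_inv
    have h3 := congrArg (fun f ↦ (mfderiv (𝓡 k) (𝓡 m) f g u : EuclideanSpace ℝ (Fin m))) h2
    exact (congrArg (fun L : EuclideanSpace ℝ (Fin k) →L[ℝ] EuclideanSpace ℝ (Fin m) ↦ L u)
      h1).symm.trans h3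
  · have h1 := mfderiv_comp g
      ((𝒢.tgt_contMDiffAt (𝒢.inv g)).mdifferentiableAt (by simp)) hi
    have h2 : 𝒢.tgt ∘ 𝒢.inv = 𝒢.src := funext 𝒢.tgt_inv
    have h3 := congrArg (fun f ↦ (mfderiv (𝓡 k) (𝓡 m) f g u : EuclideanSpace ℝ (Fin m))) h2
    exact (congrArg (fun L : EuclideanSpace ℝ (Fin k) →L[ℝ] EuclideanSpace ℝ (Fin m) ↦ L u)
      h1).symm.trans h3

/-- An orbit direction at the source lifts to a vector killed by `dt`. -/
theorem exists_lift_orbitTangent {g : G} {x : M} (hx : 𝒢.src g = x)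
    {v : EuclideanSpace ℝ (Fin m)} (hv : v ∈ 𝒢.orbitTangent x) :
    ∃ w, 𝒢.dsrc g w = v ∧ 𝒢.dtgt g w = 0 := by
  subst hx
  obtain ⟨u, hu, rfl⟩ := hv
  have hu' : 𝒢.dsrc (𝒢.one (𝒢.src g)) u = 0 := hu
  obtain ⟨u', h1, h2⟩ := 𝒢.exists_inv_tangent (𝒢.one (𝒢.src g)) u
  have hinv : 𝒢.inv (𝒢.one (𝒢.src g)) = 𝒢.one (𝒢.src g) := by
    have e1 := 𝒢.mul_inv (𝒢.one (𝒢.src g))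
    have e2 := 𝒢.one_mul (𝒢.inv (𝒢.one (𝒢.src g)))
    rw [𝒢.tgt_inv, 𝒢.src_one] at e2
    rw [𝒢.tgt_one] at e1
    exact e2.symm.trans e1
  rw [hinv] at h1 h2
  obtain ⟨w, hw1, hw2⟩ := 𝒢.exists_tangent_mul (g := g) (h := 𝒢.one (𝒢.src g))
    (𝒢.tgt_one _).symm 0 u' (by rw [h2, hu', map_zero])
  rw [𝒢.mul_one] at hw1 hw2
  exact ⟨w, hw1.trans h1, by rw [hw2, map_zero]⟩

/-- The map `T_g G → N_x O`, `w ↦ [ds w]`, for an arrow `g` with source `x`. -/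
def srcNormal {x : M} (g : G) (_hx : 𝒢.src g = x) :
    EuclideanSpace ℝ (Fin k) →ₗ[ℝ] 𝒢.NormalSpace x :=
  (𝒢.orbitTangent x).mkQ ∘ₗ 𝒢.dsrc g

/-- The map `T_g G → N_y O`, `w ↦ [dt w]`, for an arrow `g` with target `y`. -/
def tgtNormal {y : M} (g : G) (_hy : 𝒢.tgt g = y) :
    EuclideanSpace ℝ (Fin k) →ₗ[ℝ] 𝒢.NormalSpace y :=
  (𝒢.orbitTangent y).mkQ ∘ₗ 𝒢.dtgt g

theorem srcNormal_surjective {x : M} (g : G) (hx : 𝒢.src g = x) :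
    Function.Surjective (𝒢.srcNormal g hx) :=
  (Submodule.mkQ_surjective _).comp (𝒢.dsrc_surjective g)

theorem ker_srcNormal_le {x y : M} (g : G) (hx : 𝒢.src g = x) (hy : 𝒢.tgt g = y) :
    LinearMap.ker (𝒢.srcNormal g hx) ≤ LinearMap.ker (𝒢.tgtNormal g hy) := by
  intro w hw
  have hw' : 𝒢.dsrc g w ∈ 𝒢.orbitTangent x := (Submodule.Quotient.mk_eq_zero _).1 hw
  obtain ⟨w', h1, h2⟩ := 𝒢.exists_lift_orbitTangent hx hw'
  refine (Submodule.Quotient.mk_eq_zero _).2 ?_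
  have h3 := 𝒢.dtgt_mem_orbitTangent (g := g) hy (w := w - w') (by rw [map_sub, h1, sub_self])
  rwa [map_sub, h2, sub_zero] at h3

/-- The normal representation `η_g : N_x O → N_y O` of an arrow `g : x → y`: the class of `ds w`
is sent to the class of `dt w`, for all `w ∈ T_g G` (see `normalAction_srcNormal`). -/
def normalAction {x y : M} (g : G) (hx : 𝒢.src g = x) (hy : 𝒢.tgt g = y) :
    𝒢.NormalSpace x →ₗ[ℝ] 𝒢.NormalSpace y :=
  (LinearMap.ker (𝒢.srcNormal g hx)).liftQ (𝒢.tgtNormal g hy) (𝒢.ker_srcNormal_le g hx hy) ∘ₗ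
    ((𝒢.srcNormal g hx).quotKerEquivOfSurjective (𝒢.srcNormal_surjective g hx)).symm.toLinearMap

theorem normalAction_srcNormal {x y : M} (g : G) (hx : 𝒢.src g = x) (hy : 𝒢.tgt g = y)
    (w : EuclideanSpace ℝ (Fin k)) :
    𝒢.normalAction g hx hy (𝒢.srcNormal g hx w) = 𝒢.tgtNormal g hy w := by
  have : ((𝒢.srcNormal g hx).quotKerEquivOfSurjective (𝒢.srcNormal_surjective g hx)).symm
      (𝒢.srcNormal g hx w) = Submodule.Quotient.mk w := by
    rw [LinearEquiv.symm_apply_eq]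
    rfl
  simp only [normalAction, LinearMap.comp_apply, LinearEquiv.coe_coe, this]
  rfl

/-- The normal representation `G_x ↷ N_x O` of the isotropy group. -/
def normalRep (x : M) : Representation ℝ (𝒢.Isotropy x) (𝒢.NormalSpace x) where
  toFun g := 𝒢.normalAction g.1 g.2.1 g.2.2
  map_one' := by
    apply LinearMap.ext
    intro n
    obtain ⟨v, rfl⟩ := Submodule.mkQ_surjective _ n
    set w : EuclideanSpace ℝ (Fin k) := mfderiv (𝓡 m) (𝓡 k) 𝒢.one x v with hw
    have hone : MDifferentiableAt (𝓡 m) (𝓡 k) 𝒢.one x := 𝒢.one_smooth.mdifferentiableAt (by simp)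
    have hs : 𝒢.dsrc (𝒢.one x) w = v := by
      have h1 := mfderiv_comp x
        ((𝒢.src_contMDiffAt (𝒢.one x)).mdifferentiableAt (by simp)) hone
      have h2 : 𝒢.src ∘ 𝒢.one = id := funext 𝒢.src_one
      have h3 := congrArg (fun f ↦ (mfderiv (𝓡 m) (𝓡 m) f x v : EuclideanSpace ℝ (Fin m))) h2
      refine ((congrArg (fun L : EuclideanSpace ℝ (Fin m) →L[ℝ] EuclideanSpace ℝ (Fin m) ↦ L v)
        h1).symm.trans h3).trans ?_
      rw [mfderiv_id]
      rfl
    have ht : 𝒢.dtgt (𝒢.one x) w = v := by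
      have h1 := mfderiv_comp x
        ((𝒢.tgt_contMDiffAt (𝒢.one x)).mdifferentiableAt (by simp)) hone
      have h2 : 𝒢.tgt ∘ 𝒢.one = id := funext 𝒢.tgt_one
      have h3 := congrArg (fun f ↦ (mfderiv (𝓡 m) (𝓡 m) f x v : EuclideanSpace ℝ (Fin m))) h2
      refine ((congrArg (fun L : EuclideanSpace ℝ (Fin m) →L[ℝ] EuclideanSpace ℝ (Fin m) ↦ L v)
        h1).symm.trans h3).trans ?_
      rw [mfderiv_id]
      rfl
    have h := 𝒢.normalAction_srcNormal (𝒢.one x) (𝒢.src_one x) (𝒢.tgt_one x) w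
    have h1 : 𝒢.srcNormal (𝒢.one x) (𝒢.src_one x) w = (𝒢.orbitTangent x).mkQ v :=
      congrArg (𝒢.orbitTangent x).mkQ hs
    have h2 : 𝒢.tgtNormal (𝒢.one x) (𝒢.tgt_one x) w = (𝒢.orbitTangent x).mkQ v :=
      congrArg (𝒢.orbitTangent x).mkQ ht
    rw [h1, h2] at h
    exact h
  map_mul' g h := by
    apply LinearMap.ext
    intro n
    have e : 𝒢.src g.1 = 𝒢.tgt h.1 := g.2.1.trans h.2.2.symm
    obtain ⟨w, rfl⟩ := 𝒢.srcNormal_surjective h.1 h.2.1 n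
    obtain ⟨v, hv⟩ := 𝒢.dsrc_surjective g.1 (𝒢.dtgt h.1 w)
    obtain ⟨u, hu1, hu2⟩ := 𝒢.exists_tangent_mul e v w hv
    have h1 : 𝒢.srcNormal (g * h).1 (g * h).2.1 u = 𝒢.srcNormal h.1 h.2.1 w :=
      congrArg (𝒢.orbitTangent x).mkQ hu1
    have h2 : 𝒢.tgtNormal (g * h).1 (g * h).2.2 u = 𝒢.tgtNormal g.1 g.2.2 v :=
      congrArg (𝒢.orbitTangent x).mkQ hu2
    have h3 : 𝒢.srcNormal g.1 g.2.1 v = 𝒢.tgtNormal h.1 h.2.2 w :=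
      congrArg (𝒢.orbitTangent x).mkQ hv
    change 𝒢.normalAction (g * h).1 (g * h).2.1 (g * h).2.2 (𝒢.srcNormal h.1 h.2.1 w) =
      𝒢.normalAction g.1 g.2.1 g.2.2 (𝒢.normalAction h.1 h.2.1 h.2.2 (𝒢.srcNormal h.1 h.2.1 w))
    rw [𝒢.normalAction_srcNormal h.1, ← h3, 𝒢.normalAction_srcNormal g.1, ← h1,
      𝒢.normalAction_srcNormal, h2]

end LieGroupoid

/-! ### Maps of Lie groupoids -/

section Maps

variable {m k m' k' : ℕ} {M G M' G' : Type*}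
  [TopologicalSpace M] [ChartedSpace (EuclideanSpace ℝ (Fin m)) M]
  [TopologicalSpace G] [ChartedSpace (EuclideanSpace ℝ (Fin k)) G]
  [TopologicalSpace M'] [ChartedSpace (EuclideanSpace ℝ (Fin m')) M']
  [TopologicalSpace G'] [ChartedSpace (EuclideanSpace ℝ (Fin k')) G']

/-- A map of Lie groupoids: smooth maps on objects and on arrows, preserving source, target and
multiplication (hence units and inverses). -/
structure LieGroupoidHom (𝒢 : LieGroupoid m k M G) (𝒢' : LieGroupoid m' k' M' G') where
  ob : M → M'
  ar : G → G'
  ob_smooth : ContMDiff (𝓡 m) (𝓡 m') ∞ ob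
  ar_smooth : ContMDiff (𝓡 k) (𝓡 k') ∞ ar
  src_ar : ∀ g, 𝒢'.src (ar g) = ob (𝒢.src g)
  tgt_ar : ∀ g, 𝒢'.tgt (ar g) = ob (𝒢.tgt g)
  ar_mul : ∀ g h, 𝒢.src g = 𝒢.tgt h → ar (𝒢.mul g h) = 𝒢'.mul (ar g) (ar h)

namespace LieGroupoidHom

variable {𝒢 : LieGroupoid m k M G} {𝒢' : LieGroupoid m' k' M' G'} (φ : LieGroupoidHom 𝒢 𝒢')

theorem ar_one (x : M) : φ.ar (𝒢.one x) = 𝒢'.one (φ.ob x) := by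
  set a := φ.ar (𝒢.one x) with ha
  have hs : 𝒢'.src a = φ.ob x := by rw [ha, φ.src_ar, 𝒢.src_one]
  have ht : 𝒢'.tgt a = φ.ob x := by rw [ha, φ.tgt_ar, 𝒢.tgt_one]
  have haa : 𝒢'.mul a a = a := by
    rw [ha, ← φ.ar_mul _ _ (by rw [𝒢.src_one, 𝒢.tgt_one])]
    have := 𝒢.mul_one (𝒢.one x)
    rw [𝒢.src_one] at this
    rw [this]
  have h1 := 𝒢'.mul_assoc (𝒢'.inv a) a a (𝒢'.src_inv a) (hs.trans ht.symm)
  rw [𝒢'.inv_mul, haa, 𝒢'.inv_mul, hs] at h1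
  have h2 := 𝒢'.one_mul a
  rw [ht] at h2
  exact h2.symm.trans h1

/-- `φ` is fully faithful: the square formed by `φ` and the anchors is a good pullback. -/
def IsFullyFaithful : Prop :=
  IsGoodPullback.{w} (𝓡 k) ((𝓡 m).prod (𝓡 m)) (𝓡 k') ((𝓡 m').prod (𝓡 m'))
    𝒢.anchor φ.ar (Prod.map φ.ob φ.ob) 𝒢'.anchor

/-- `φ` is essentially surjective: the map `t ∘ pr₁ : G' ×_{M'} M → M'` is a surjective submersion
on the manifold of pairs `(g', x)` with `s g' = φ x`. Since `s` is a submersion, this is a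
submanifold of `G' × M` whose tangent spaces are the fibre products of those of `G'` and `M`. -/
structure IsEssentiallySurjective : Prop where
  surjective : Set.SurjOn (fun p : G' × M ↦ 𝒢'.tgt p.1) (fiberProduct 𝒢'.src φ.ob) Set.univ
  submersion : ∀ p ∈ fiberProduct 𝒢'.src φ.ob,
    Set.SurjOn (fun w ↦ mfderiv (𝓡 k') (𝓡 m') 𝒢'.tgt p.1 w.1)
      (fiberProductTangent (𝓡 k') (𝓡 m) (𝓡 m') 𝒢'.src φ.ob p.1 p.2) Set.univ

/-- A weak equivalence is a fully faithful and essentially surjective map. -/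
def IsWeakEquivalence : Prop :=
  IsFullyFaithful.{w} φ ∧ φ.IsEssentiallySurjective

/-- The map `φ_* : M/G → M'/G'` of orbit spaces. -/
def orbitMap : 𝒢.OrbitSpace → 𝒢'.OrbitSpace :=
  Quotient.map φ.ob (by
    rintro _ _ ⟨g, rfl, rfl⟩
    exact ⟨φ.ar g, φ.src_ar g, φ.tgt_ar g⟩)

/-- The group homomorphism `G_x → G'_{φ(x)}`. -/
def isotropyMap (x : M) : 𝒢.Isotropy x →* 𝒢'.Isotropy (φ.ob x) where
  toFun g := ⟨φ.ar g.1, by rw [φ.src_ar, g.2.1], by rw [φ.tgt_ar, g.2.2]⟩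
  map_one' := Subtype.ext (φ.ar_one x)
  map_mul' g h := Subtype.ext (φ.ar_mul _ _ (g.2.1.trans h.2.2.symm))

theorem dsrc_ar (g : G) (w : EuclideanSpace ℝ (Fin k)) :
    𝒢'.dsrc (φ.ar g) (mfderiv (𝓡 k) (𝓡 k') φ.ar g w) =
      (mfderiv (𝓡 m) (𝓡 m') φ.ob (𝒢.src g) (𝒢.dsrc g w) : EuclideanSpace ℝ (Fin m')) := by
  have h1 := mfderiv_comp g ((𝒢'.src_contMDiffAt (φ.ar g)).mdifferentiableAt (by simp))
    (φ.ar_smooth.mdifferentiableAt (by simp) (x := g))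
  have h2 := mfderiv_comp g (φ.ob_smooth.mdifferentiableAt (by simp) (x := 𝒢.src g))
    ((𝒢.src_contMDiffAt g).mdifferentiableAt (by simp))
  have h3 : 𝒢'.src ∘ φ.ar = φ.ob ∘ 𝒢.src := funext φ.src_ar
  have h4 := congrArg (fun f ↦ (mfderiv (𝓡 k) (𝓡 m') f g w : EuclideanSpace ℝ (Fin m'))) h3
  have h1' := congrArg
    (fun L : EuclideanSpace ℝ (Fin k) →L[ℝ] EuclideanSpace ℝ (Fin m') ↦ L w) h1
  have h2' := congrArg
    (fun L : EuclideanSpace ℝ (Fin k) →L[ℝ] EuclideanSpace ℝ (Fin m') ↦ L w) h2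
  exact h1'.symm.trans (h4.trans h2')

theorem dtgt_ar (g : G) (w : EuclideanSpace ℝ (Fin k)) :
    𝒢'.dtgt (φ.ar g) (mfderiv (𝓡 k) (𝓡 k') φ.ar g w) =
      (mfderiv (𝓡 m) (𝓡 m') φ.ob (𝒢.tgt g) (𝒢.dtgt g w) : EuclideanSpace ℝ (Fin m')) := by
  have h1 := mfderiv_comp g ((𝒢'.tgt_contMDiffAt (φ.ar g)).mdifferentiableAt (by simp))
    (φ.ar_smooth.mdifferentiableAt (by simp) (x := g))
  have h2 := mfderiv_comp g (φ.ob_smooth.mdifferentiableAt (by simp) (x := 𝒢.tgt g))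
    ((𝒢.tgt_contMDiffAt g).mdifferentiableAt (by simp))
  have h3 : 𝒢'.tgt ∘ φ.ar = φ.ob ∘ 𝒢.tgt := funext φ.tgt_ar
  have h4 := congrArg (fun f ↦ (mfderiv (𝓡 k) (𝓡 m') f g w : EuclideanSpace ℝ (Fin m'))) h3
  have h1' := congrArg
    (fun L : EuclideanSpace ℝ (Fin k) →L[ℝ] EuclideanSpace ℝ (Fin m') ↦ L w) h1
  have h2' := congrArg
    (fun L : EuclideanSpace ℝ (Fin k) →L[ℝ] EuclideanSpace ℝ (Fin m') ↦ L w) h2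
  exact h1'.symm.trans (h4.trans h2')

/-- The differential of `φ` maps `T_x O` to `T_{φ(x)} O'`. -/
theorem orbitTangent_le (x : M) : 𝒢.orbitTangent x ≤ (𝒢'.orbitTangent (φ.ob x)).comap
    (mfderiv (𝓡 m) (𝓡 m') φ.ob x).toLinearMap := by
  rintro _ ⟨u, hu, rfl⟩
  have hu' : 𝒢.dsrc (𝒢.one x) u = 0 := hu
  have h1 := φ.dsrc_ar (𝒢.one x) u
  have h2 := φ.dtgt_ar (𝒢.one x) u
  rw [φ.ar_one] at h1 h2
  rw [hu', 𝒢.src_one] at h1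
  rw [𝒢.tgt_one] at h2
  refine ⟨mfderiv (𝓡 k) (𝓡 k') φ.ar (𝒢.one x) u, ?_, h2⟩
  exact h1.trans (map_zero (mfderiv (𝓡 m) (𝓡 m') φ.ob x))

/-- The map `φ_* : N_x O → N_{φ(x)} O'` of normal spaces induced by the differential of `φ`. -/
def normalMap (x : M) : 𝒢.NormalSpace x →ₗ[ℝ] 𝒢'.NormalSpace (φ.ob x) :=
  Submodule.mapQ _ _ (mfderiv (𝓡 m) (𝓡 m') φ.ob x).toLinearMap (φ.orbitTangent_le x)

variable [IsManifold (𝓡 m) ∞ M] [IsManifold (𝓡 k) ∞ G]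
  [IsManifold (𝓡 m') ∞ M'] [IsManifold (𝓡 k') ∞ G']

/-- `φ` induces an isomorphism `(G_x ↷ N_x O) ≅ (G'_{φ(x)} ↷ N_{φ(x)} O')` of Lie group
representations: the homomorphism `G_x → G'_{φ(x)}` is an isomorphism of Lie groups, the map
`N_x O → N_{φ(x)} O'` is a linear isomorphism, and the latter is equivariant along the former. -/
structure IsNormalRepIsoAt (x : M) : Prop where
  /-- the homomorphism of isotropy groups is bijective -/
  isotropy_bijective : Function.Bijective (φ.isotropyMap x)
  /-- it is a diffeomorphism of the embedded submanifolds `G_x ⊆ G` and `G'_{φ(x)} ⊆ G'` -/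
  isotropy_diffeo : RestrictsToDiffeo (𝓡 k) (𝓡 k') φ.ar (𝒢.isotropySet x)
    (𝒢'.isotropySet (φ.ob x))
  normal_bijective : Function.Bijective (φ.normalMap x)
  equivariant : ∀ (g : 𝒢.Isotropy x) (n : 𝒢.NormalSpace x),
    φ.normalMap x (𝒢.normalRep x g n) =
      𝒢'.normalRep (φ.ob x) (φ.isotropyMap x g) (φ.normalMap x n)

end LieGroupoidHom

end Maps

end

/-! Essential surjectivity and full faithfulness each split into a set-level statement and a tangent
statement, and these match bijectivity of the orbit map, bijectivity on isotropy groups, and the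
isomorphisms of normal spaces.

From a weak equivalence: full faithfulness makes the orbit map injective, essential surjectivity
makes it surjective, and it is open because the submersion `t ∘ pr₁` on `G' ×_{M'} M` is open. The
isotropy groups correspond because an arrow of `G` is an arrow of `G'` together with lifts of its
two end points. The inverse is smooth because `(anchor, φ)` has injective differential and hence
smooth local retractions. At a unit arrow, exactness of the tangent sequence gives injectivity on
normal spaces and essential surjectivity gives surjectivity. Equivariance is automatic.

Conversely, essential surjectivity is linear algebra with the normal spaces. For full faithfulness,
injectivity on orbits and bijectivity on isotropy groups give the pullback of sets, since the arrows
between two objects of one orbit form a torsor under isotropy. At the tangent level, surjectivity of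
`ds` and injectivity on normal spaces reduce exactness to vectors killed by both `ds` and `dt`.
Isotropy groups are handled as subsets, so such a vector must be realised as the velocity of a curve
of arrows with fixed source and target (`LieGroupoid.exists_curve_of_dsrc_of_dtgt`). This is a
constant rank argument: the rank of `t` on a source fibre is the dimension of the orbit, constant
along the orbit because the normal representation identifies normal spaces. Along such curves the
smooth inverse on isotropy, translated to other arrows by `exists_homInverse`, transfers velocities
in both directions.

Finally `isGoodPullback_of_bijective` upgrades a pullback of sets with exact tangent sequences to a
good pullback. No transversality is needed: exactness alone forces the square to cover a
neighbourhood in the fibre product (`eventually_exists_of_exact`), which gives the homeomorphism,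
and local retractions give the universal property. -/

/-! ### The differential as a map of model spaces -/

section ModelDeriv

variable {E H P E' H' N E'' H'' Q : Type*}
  [NormedAddCommGroup E] [NormedSpace ℝ E] [TopologicalSpace H]
  [TopologicalSpace P] [ChartedSpace H P]
  [NormedAddCommGroup E'] [NormedSpace ℝ E'] [TopologicalSpace H']
  [TopologicalSpace N] [ChartedSpace H' N]
  [NormedAddCommGroup E''] [NormedSpace ℝ E''] [TopologicalSpace H'']
  [TopologicalSpace Q] [ChartedSpace H'' Q]

/-- The differential of a map of manifolds, as a map between the model vector spaces. -/
noncomputable def modelDeriv (I : ModelWithCorners ℝ E H) (J : ModelWithCorners ℝ E' H')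
    (F : P → N) (x : P) : E →L[ℝ] E' :=
  mfderiv I J F x

variable {I : ModelWithCorners ℝ E H} {J : ModelWithCorners ℝ E' H'}
  {K : ModelWithCorners ℝ E'' H''}

theorem HasMFDerivAt.modelDeriv_eq {F : P → N} {x : P} {L : E →L[ℝ] E'}
    (h : HasMFDerivAt I J F x L) : modelDeriv I J F x = L :=
  h.mfderiv

theorem MDifferentiableAt.hasMFDerivAt_modelDeriv {F : P → N} {x : P}
    (h : MDifferentiableAt I J F x) : HasMFDerivAt I J F x (modelDeriv I J F x : E →L[ℝ] E') :=
  h.hasMFDerivAt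

/-- The intermediate point is a free `y`, so the chain rule applies when `F x` and the base point
agree only propositionally, with no transport between tangent spaces. -/
theorem modelDeriv_comp {F : P → N} {g : N → Q} {x : P} {y : N} (hy : F x = y)
    (hg : MDifferentiableAt J K g y) (hF : MDifferentiableAt I J F x) :
    modelDeriv I K (fun z ↦ g (F z)) x = (modelDeriv J K g y).comp (modelDeriv I J F x) := by
  subst hy
  exact mfderiv_comp x hg hF

theorem modelDeriv_prodMk {F : P → N} {g : P → Q} {x : P}
    (hF : MDifferentiableAt I J F x) (hg : MDifferentiableAt I K g x) :
    modelDeriv I (J.prod K) (fun z ↦ (F z, g z)) x =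
      (modelDeriv I J F x).prod (modelDeriv I K g x) :=
  mfderiv_prodMk hF hg

theorem modelDeriv_prodMap {H₁ N₁ E₁ : Type*}
    [NormedAddCommGroup E₁] [NormedSpace ℝ E₁] [TopologicalSpace H₁]
    [TopologicalSpace N₁] [ChartedSpace H₁ N₁] {I₁ : ModelWithCorners ℝ E₁ H₁}
    {f : P → N} {g : Q → N₁} {p : P × Q}
    (hf : MDifferentiableAt I J f p.1) (hg : MDifferentiableAt K I₁ g p.2) :
    modelDeriv (I.prod K) (J.prod I₁) (Prod.map f g) p =
      (modelDeriv I J f p.1).prodMap (modelDeriv K I₁ g p.2) :=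
  mfderiv_prodMap hf hg

theorem modelDeriv_congr {F F₁ : P → N} {x : P} (h : F =ᶠ[𝓝 x] F₁) :
    modelDeriv I J F x = modelDeriv I J F₁ x :=
  h.mfderiv_eq

theorem modelDeriv_eq_fderiv {f : E → E'} {e : E} :
    modelDeriv 𝓘(ℝ, E) 𝓘(ℝ, E') f e = fderiv ℝ f e :=
  mfderiv_eq_fderiv

end ModelDeriv

/-! ### Inverse function theorem on manifolds -/

section InverseFunction

variable {E H P E' H' N : Type*}
  [NormedAddCommGroup E] [NormedSpace ℝ E] [FiniteDimensional ℝ E] [TopologicalSpace H]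
  {I : ModelWithCorners ℝ E H} [I.Boundaryless]
  [TopologicalSpace P] [ChartedSpace H P] [IsManifold I ∞ P]
  [NormedAddCommGroup E'] [NormedSpace ℝ E'] [FiniteDimensional ℝ E'] [TopologicalSpace H']
  {J : ModelWithCorners ℝ E' H'} [J.Boundaryless]
  [TopologicalSpace N] [ChartedSpace H' N] [IsManifold J ∞ N]

omit [FiniteDimensional ℝ E] [IsManifold I ∞ P] [FiniteDimensional ℝ E'] [J.Boundaryless]
  [IsManifold J ∞ N] in
/-- In boundaryless charts, `mfderiv` is the derivative of the coordinate expression. -/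
theorem ContMDiffAt.hasFDerivAt_writtenInExtChartAt {F : P → N} {x : P}
    (hF : ContMDiffAt I J ∞ F x) :
    ContDiffAt ℝ ∞ (writtenInExtChartAt I J x F) (extChartAt I x x) ∧
      HasFDerivAt (writtenInExtChartAt I J x F) (modelDeriv I J F x) (extChartAt I x x) := by
  have h1 := (contMDiffAt_iff.1 hF).2
  rw [I.range_eq_univ, contDiffWithinAt_univ] at h1
  have h2 : HasFDerivWithinAt (writtenInExtChartAt I J x F) (modelDeriv I J F x) (Set.range I)
    (extChartAt I x x) := (hF.mdifferentiableAt (by simp)).hasMFDerivAt.2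
  rw [I.range_eq_univ, hasFDerivWithinAt_univ] at h2
  exact ⟨h1, h2⟩

omit [J.Boundaryless] [IsManifold J ∞ N] in
/-- A smooth map with injective differential has a smooth local left inverse. -/
theorem ContMDiffAt.exists_leftInverse {F : P → N} {x : P} (hF : ContMDiffAt I J ∞ F x)
    (hinj : Function.Injective (modelDeriv I J F x)) :
    ∃ r : N → P, ContMDiffAt J I ∞ r (F x) ∧ ∀ᶠ y in 𝓝 x, r (F y) = y := by
  obtain ⟨h1, h2⟩ := hF.hasFDerivAt_writtenInExtChartAt
  set f := writtenInExtChartAt I J x F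
  set e := extChartAt I x x with he
  -- Composing the coordinate expression with a linear left inverse `L` of its derivative gives a
  -- self-map of `E` with derivative the identity, to which the inverse function theorem applies.
  obtain ⟨L₀, hL₀⟩ := LinearMap.exists_leftInverse_of_injective
    (modelDeriv I J F x).toLinearMap (LinearMap.ker_eq_bot.2 hinj)
  set L : E' →L[ℝ] E := L₀.toContinuousLinearMap
  have hL : L.comp (modelDeriv I J F x) =
      (ContinuousLinearEquiv.refl ℝ E : E →L[ℝ] E) := by
    ext v
    exact LinearMap.congr_fun hL₀ v
  have hg : ContDiffAt ℝ ∞ (L ∘ f) e := L.contDiff.contDiffAt.comp e h1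
  have hg' : HasFDerivAt (L ∘ f) ((ContinuousLinearEquiv.refl ℝ E : E →L[ℝ] E)) e := by
    rw [← hL]
    exact L.hasFDerivAt.comp e h2
  set j := hg.localInverse hg' (by simp)
  have hj : ContDiffAt ℝ ∞ j (L (f e)) := hg.to_localInverse hg' (by simp)
  have hj0 : j (L (f e)) = e := hg.localInverse_apply_image hg' (by simp)
  have hj1 : ∀ᶠ e' in 𝓝 e, j (L (f e')) = e' :=
    (hg.hasStrictFDerivAt' hg' (by simp)).eventually_left_inverse
  have hfe : f e = extChartAt J (F x) (F x) := by
    simp [f, e, writtenInExtChartAt]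
  refine ⟨fun y ↦ (extChartAt I x).symm (j (L (extChartAt J (F x) y))), ?_, ?_⟩
  · have a1 : ContMDiffAt J 𝓘(ℝ, E') ∞ (extChartAt J (F x)) (F x) := contMDiffAt_extChartAt
    have a2 : ContMDiffAt 𝓘(ℝ, E') 𝓘(ℝ, E) ∞ (fun u ↦ j (L u)) (extChartAt J (F x) (F x)) := by
      apply ContDiffAt.contMDiffAt
      apply ContDiffAt.comp _ _ L.contDiff.contDiffAt
      rw [← hfe]
      exact hj
    have a3 : ContMDiffAt 𝓘(ℝ, E) I ∞ (extChartAt I x).symm (j (L (extChartAt J (F x) (F x)))) := by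
      rw [← hfe, hj0]
      exact (contMDiffOn_extChartAt_symm x).contMDiffAt (extChartAt_target_mem_nhds x)
    exact a3.comp (F x) (a2.comp (F x) a1)
  · have b1 := (continuousAt_extChartAt (I := I) x).eventually hj1
    filter_upwards [b1, extChartAt_source_mem_nhds (I := I) x] with y hy1 hy2
    have : f (extChartAt I x y) = extChartAt J (F x) (F y) := by
      simp only [f, writtenInExtChartAt, Function.comp_apply, (extChartAt I x).left_inv hy2]
    rw [this] at hy1
    rw [hy1, (extChartAt I x).left_inv hy2]

omit [IsManifold I ∞ P] [IsManifold J ∞ N] in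
/-- A smooth map with surjective differential is open at the point. -/
theorem ContMDiffAt.map_nhds_eq_of_surjective {F : P → N} {x : P} (hF : ContMDiffAt I J ∞ F x)
    (hsurj : Function.Surjective (modelDeriv I J F x)) : Filter.map F (𝓝 x) = 𝓝 (F x) := by
  obtain ⟨h1, h2⟩ := hF.hasFDerivAt_writtenInExtChartAt
  set f := writtenInExtChartAt I J x F
  set e := extChartAt I x x with he
  have h3 : Filter.map f (𝓝 e) = 𝓝 (f e) :=
    (h1.hasStrictFDerivAt' h2 (by simp)).map_nhds_eq_of_surj (LinearMap.range_eq_top.2 hsurj)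
  have hfe : f e = extChartAt J (F x) (F x) := by
    simp [f, e, writtenInExtChartAt]
  have h4 : Filter.map (extChartAt J (F x)).symm (𝓝 (extChartAt J (F x) (F x))) = 𝓝 (F x) := by
    have := map_extChartAt_symm_nhdsWithin_range (I := J) (F x)
    rwa [J.range_eq_univ, nhdsWithin_univ] at this
  rw [← h4, ← hfe, ← h3, he, ← map_extChartAt_nhds_of_boundaryless (I := I) x, Filter.map_map,
    Filter.map_map]
  apply Filter.map_congr
  filter_upwards [hF.continuousAt.preimage_mem_nhds (extChartAt_source_mem_nhds (I := J) (F x)),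
    extChartAt_source_mem_nhds (I := I) x] with y hy1 hy2
  simp only [f, writtenInExtChartAt, Function.comp_apply, (extChartAt I x).left_inv hy2]
  exact ((extChartAt J (F x)).left_inv hy1).symm

end InverseFunction

/-! ### Local equations for fibre products -/

section Difference

variable {E₁ H₁ M₁ E₂ H₂ M₂ E H M : Type*}
  [NormedAddCommGroup E₁] [NormedSpace ℝ E₁] [TopologicalSpace H₁] [TopologicalSpace M₁]
  [ChartedSpace H₁ M₁]
  [NormedAddCommGroup E₂] [NormedSpace ℝ E₂] [TopologicalSpace H₂] [TopologicalSpace M₂]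
  [ChartedSpace H₂ M₂]
  [NormedAddCommGroup E] [NormedSpace ℝ E] [TopologicalSpace H] [TopologicalSpace M]
  [ChartedSpace H M]
  {I₁ : ModelWithCorners ℝ E₁ H₁} {I₂ : ModelWithCorners ℝ E₂ H₂} {I : ModelWithCorners ℝ E H}
  [IsManifold I ∞ M]

/-- The preferred chart at a point has the identity as differential there, so reading `f` in the
chart at its value leaves the model derivative unchanged. -/
theorem MDifferentiableAt.hasMFDerivAt_extChartAt_comp {f : M₁ → M} {x : M₁} {y : M}
    (hxy : f x = y) (hf : MDifferentiableAt I₁ I f x) :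
    HasMFDerivAt I₁ 𝓘(ℝ, E) (fun z ↦ extChartAt I y (f z)) x
      (modelDeriv I₁ I f x : E₁ →L[ℝ] E) := by
  subst hxy
  have h1 : HasMFDerivAt I 𝓘(ℝ, E) (extChartAt I (f x)) (f x) (ContinuousLinearMap.id ℝ E) := by
    have h := (mdifferentiableAt_extChartAt (I := I) (mem_chart_source H (f x))).hasMFDerivAt
    rwa [mfderiv_extChartAt_self] at h
  exact h1.comp x hf.hasMFDerivAt_modelDeriv

/-- Locally near a point of the fibre product, the fibre product is the zero set of a smooth
function with values in the model space, whose differential is `(v, w) ↦ d f₁ v - d f₂ w`. -/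
theorem exists_localDifference {f₁ : M₁ → M} {f₂ : M₂ → M} {x₁ : M₁} {x₂ : M₂}
    (h : f₁ x₁ = f₂ x₂) (hf₁ : ContMDiffAt I₁ I ∞ f₁ x₁) (hf₂ : ContMDiffAt I₂ I ∞ f₂ x₂) :
    ∃ Θ : M₁ × M₂ → E, ContMDiffAt (I₁.prod I₂) 𝓘(ℝ, E) ∞ Θ (x₁, x₂) ∧
      (∀ᶠ p in 𝓝 (x₁, x₂), Θ p = 0 ↔ f₁ p.1 = f₂ p.2) ∧
      ∀ (v : E₁) (w : E₂), modelDeriv (I₁.prod I₂) 𝓘(ℝ, E) Θ (x₁, x₂) (v, w) =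
        modelDeriv I₁ I f₁ x₁ v - modelDeriv I₂ I f₂ x₂ w := by
  have c₁ : ContMDiffAt (I₁.prod I₂) I₁ ∞ (Prod.fst : M₁ × M₂ → M₁) (x₁, x₂) := contMDiffAt_fst
  have c₂ : ContMDiffAt (I₁.prod I₂) I₂ ∞ (Prod.snd : M₁ × M₂ → M₂) (x₁, x₂) := contMDiffAt_snd
  have s₁ : ContMDiffAt I 𝓘(ℝ, E) ∞ (extChartAt I (f₁ x₁)) (f₁ x₁) := contMDiffAt_extChartAt
  have s₂ : ContMDiffAt I 𝓘(ℝ, E) ∞ (extChartAt I (f₁ x₁)) (f₂ x₂) := h ▸ s₁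
  have e₁ : ContMDiffAt (I₁.prod I₂) I ∞ (fun p : M₁ × M₂ ↦ f₁ p.1) (x₁, x₂) :=
    ContMDiffAt.comp (x₁, x₂) hf₁ c₁
  have e₂ : ContMDiffAt (I₁.prod I₂) I ∞ (fun p : M₁ × M₂ ↦ f₂ p.2) (x₁, x₂) :=
    ContMDiffAt.comp (x₁, x₂) hf₂ c₂
  refine ⟨fun p ↦ extChartAt I (f₁ x₁) (f₁ p.1) - extChartAt I (f₁ x₁) (f₂ p.2), ?_, ?_, ?_⟩
  · exact (s₁.comp (x₁, x₂) e₁).sub (ContMDiffAt.comp (x₁, x₂) s₂ e₂)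
  · have o := extChartAt_source_mem_nhds (I := I) (f₁ x₁)
    have o₂ : (extChartAt I (f₁ x₁)).source ∈ 𝓝 (f₂ x₂) := by
      rw [← h]
      exact o
    filter_upwards [e₁.continuousAt.preimage_mem_nhds o,
      e₂.continuousAt.preimage_mem_nhds o₂] with p h1 h2
    rw [sub_eq_zero]
    exact ⟨fun hp ↦ (extChartAt I (f₁ x₁)).injOn h1 h2 hp, fun hp ↦ by rw [hp]⟩
  · intro v w
    have d₁ := MDifferentiableAt.hasMFDerivAt_extChartAt_comp (f := fun p : M₁ × M₂ ↦ f₁ p.1)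
      (y := f₁ x₁) rfl (e₁.mdifferentiableAt (by simp))
    have d₂ := MDifferentiableAt.hasMFDerivAt_extChartAt_comp (f := fun p : M₁ × M₂ ↦ f₂ p.2)
      (y := f₁ x₁) h.symm (e₂.mdifferentiableAt (by simp))
    have d := HasMFDerivAt.modelDeriv_eq (L := modelDeriv (I₁.prod I₂) I (fun p ↦ f₁ p.1) (x₁, x₂) -
      modelDeriv (I₁.prod I₂) I (fun p ↦ f₂ p.2) (x₁, x₂)) (d₁.sub d₂)
    have p₁ : modelDeriv (I₁.prod I₂) I₁ (Prod.fst : M₁ × M₂ → M₁) (x₁, x₂) =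
      ContinuousLinearMap.fst ℝ E₁ E₂ := mfderiv_fst
    have p₂ : modelDeriv (I₁.prod I₂) I₂ (Prod.snd : M₁ × M₂ → M₂) (x₁, x₂) =
      ContinuousLinearMap.snd ℝ E₁ E₂ := mfderiv_snd
    have q₁ := modelDeriv_comp (y := x₁) rfl (hf₁.mdifferentiableAt (by simp))
      (c₁.mdifferentiableAt (by simp))
    have q₂ := modelDeriv_comp (y := x₂) rfl (hf₂.mdifferentiableAt (by simp))
      (c₂.mdifferentiableAt (by simp))
    rw [q₁, q₂, p₁, p₂] at d
    exact congrArg (fun L : E₁ × E₂ →L[ℝ] E ↦ L (v, w)) d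

end Difference

/-! ### Curves in fibres of maps of constant rank -/

section ConstantRank

variable {E A B : Type*}
  [NormedAddCommGroup E] [NormedSpace ℝ E] [FiniteDimensional ℝ E]
  [NormedAddCommGroup A] [NormedSpace ℝ A] [FiniteDimensional ℝ A]
  [NormedAddCommGroup B] [NormedSpace ℝ B] [FiniteDimensional ℝ B]

omit [FiniteDimensional ℝ E] in
/-- Vectors in the kernel of a surjective differential are velocities of curves in the fibre. -/
theorem ContDiffAt.exists_curve_of_surjective {Ψ : E → A} {e : E} (hΨ : ContDiffAt ℝ ∞ Ψ e)
    (hsurj : Function.Surjective (fderiv ℝ Ψ e)) {w : E} (hw : fderiv ℝ Ψ e w = 0) :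
    ∃ c : ℝ → E, ContDiffAt ℝ ∞ c 0 ∧ c 0 = e ∧ HasDerivAt c w 0 ∧
      ∀ᶠ τ in 𝓝 (0 : ℝ), Ψ (c τ) = Ψ e := by
  obtain ⟨R₀, hR₀⟩ := LinearMap.exists_rightInverse_of_surjective
    (fderiv ℝ Ψ e).toLinearMap (LinearMap.range_eq_top.2 hsurj)
  set R : A →L[ℝ] E := R₀.toContinuousLinearMap
  have hR : ∀ a, fderiv ℝ Ψ e (R a) = a := fun a ↦ LinearMap.congr_fun hR₀ a
  set Λ : ℝ × A →L[ℝ] E := (ContinuousLinearMap.fst ℝ ℝ A).smulRight w +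
    R.comp (ContinuousLinearMap.snd ℝ ℝ A) with hΛ
  have hΛa : ∀ p, Λ p = p.1 • w + R p.2 := fun p ↦ rfl
  have hin : HasFDerivAt (fun p ↦ e + Λ p) Λ 0 := Λ.hasFDerivAt.const_add e
  have hΨ0 : ContDiffAt ℝ ∞ Ψ (e + Λ 0) := by simpa using hΨ
  have hd : HasFDerivAt Ψ (fderiv ℝ Ψ e) (e + Λ 0) := by
    simpa using (hΨ.differentiableAt (by simp)).hasFDerivAt
  -- With `R` a right inverse of `dΨ` and `dΨ w = 0`, the derivative of `g` at `0` is the identity.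
  -- Its local inverse adjusts the line `e + τ • w` in the directions of `R` so as to stay in the
  -- fibre. The derivative of that inverse is again the identity, so the initial velocity remains
  -- `w`.
  set g : ℝ × A → ℝ × A := fun p ↦ (p.1, Ψ (e + Λ p)) with hg
  have hg1 : ContDiffAt ℝ ∞ g 0 :=
    contDiffAt_fst.prodMk (hΨ0.comp (0 : ℝ × A) (by fun_prop))
  have hg2 : HasFDerivAt g (ContinuousLinearEquiv.refl ℝ (ℝ × A) : ℝ × A →L[ℝ] ℝ × A) 0 := by
    have h := (ContinuousLinearMap.fst ℝ ℝ A).hasFDerivAt.prodMk (hd.comp (0 : ℝ × A) hin)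
    convert! h using 1
    refine ContinuousLinearMap.ext fun p ↦ Prod.ext rfl ?_
    simp [hΛa, hw, hR]
  set j := hg1.localInverse hg2 (by simp)
  have hj : ContDiffAt ℝ ∞ j (g 0) := hg1.to_localInverse hg2 (by simp)
  have hj0 : j (g 0) = 0 := hg1.localInverse_apply_image hg2 (by simp)
  have hst := hg1.hasStrictFDerivAt' hg2 (by simp)
  have hj1 : ∀ᶠ q in 𝓝 (g 0), g (j q) = q := hst.eventually_right_inverse
  have hj2 : HasFDerivAt j (ContinuousLinearMap.id ℝ (ℝ × A)) (g 0) :=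
    hst.to_localInverse.hasFDerivAt
  have hg0 : g 0 = (0, Ψ e) := by simp [hg]
  rw [hg0] at hj hj0 hj1 hj2
  have hi : ContDiff ℝ ∞ (fun τ : ℝ ↦ (τ, Ψ e)) := by fun_prop
  have hi' : HasDerivAt (fun τ : ℝ ↦ (τ, Ψ e)) ((1 : ℝ), (0 : A)) 0 :=
    (hasDerivAt_id (0 : ℝ)).prodMk (hasDerivAt_const 0 (Ψ e))
  refine ⟨fun τ ↦ e + Λ (j (τ, Ψ e)), ?_, by simp [hj0], ?_, ?_⟩
  · exact contDiffAt_const.add (Λ.contDiff.contDiffAt.comp (0 : ℝ)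
      (ContDiffAt.comp (0 : ℝ) hj hi.contDiffAt))
  · have h := (Λ.hasFDerivAt.comp_hasDerivAt (0 : ℝ)
      (HasFDerivAt.comp_hasDerivAt (0 : ℝ) hj2 hi')).const_add e
    convert! h using 1
    simp [hΛa]
  · filter_upwards [hi.continuous.continuousAt.eventually hj1] with τ hτ
    exact congrArg Prod.snd hτ

omit [FiniteDimensional ℝ E] in
/-- The set of points where the differential is surjective is open. -/
theorem ContDiffAt.eventually_surjective_fderiv {Ψ : E → A} {e : E} (hΨ : ContDiffAt ℝ ∞ Ψ e)
    (hsurj : Function.Surjective (fderiv ℝ Ψ e)) :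
    ∀ᶠ e' in 𝓝 e, Function.Surjective (fderiv ℝ Ψ e') := by
  obtain ⟨R₀, hR₀⟩ := LinearMap.exists_rightInverse_of_surjective
    (fderiv ℝ Ψ e).toLinearMap (LinearMap.range_eq_top.2 hsurj)
  set R : A →L[ℝ] E := R₀.toContinuousLinearMap
  have hR : (fderiv ℝ Ψ e).comp R = (ContinuousLinearEquiv.refl ℝ A : A →L[ℝ] A) := by
    ext a
    exact LinearMap.congr_fun hR₀ a
  have hc : ContinuousAt (fun e' ↦ (fderiv ℝ Ψ e').comp R) e :=
    (hΨ.fderiv_right (m := 0) (by simp)).continuousAt.clm_comp continuousAt_const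
  -- At `e` the operator `dΨ ∘ R` is the identity. Invertible operators form an open set, and
  -- invertibility of `dΨ ∘ R` at nearby points forces `dΨ` to be surjective there.
  have hn := hc.preimage_mem_nhds
    (hR ▸ (ContinuousLinearEquiv.nhds (ContinuousLinearEquiv.refl ℝ A)))
  filter_upwards [hn] with e' ⟨u, hu⟩ a
  obtain ⟨b, hb⟩ := u.surjective a
  exact ⟨R b, (congrArg (fun L : A →L[ℝ] A ↦ L b) hu).symm.trans hb⟩

/-- If `T` has constant rank on the fibre of the submersion `S`, then vectors killed by the
differentials of `S` and `T` are velocities of curves in the common fibre. -/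
theorem exists_curve_of_constant_rank {S : E → A} {T : E → B} {e : E}
    (hS : ContDiffAt ℝ ∞ S e) (hT : ContDiffAt ℝ ∞ T e)
    (hsurj : Function.Surjective (fderiv ℝ S e))
    (hrank : ∀ᶠ e' in 𝓝 e, S e' = S e →
      Module.finrank ℝ ((LinearMap.ker (fderiv ℝ S e').toLinearMap).map
          (fderiv ℝ T e').toLinearMap) ≤
        Module.finrank ℝ ((LinearMap.ker (fderiv ℝ S e).toLinearMap).map
          (fderiv ℝ T e).toLinearMap))
    {w : E} (hw : fderiv ℝ S e w = 0) (hw' : fderiv ℝ T e w = 0) :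
    ∃ c : ℝ → E, ContDiffAt ℝ ∞ c 0 ∧ c 0 = e ∧ HasDerivAt c w 0 ∧
      ∀ᶠ τ in 𝓝 (0 : ℝ), S (c τ) = S e ∧ T (c τ) = T e := by
  set V := (LinearMap.ker (fderiv ℝ S e).toLinearMap).map (fderiv ℝ T e).toLinearMap with hV
  obtain ⟨π₀, hπ₀⟩ := V.exists_isCompl
  set π : B →L[ℝ] V := (V.projectionOnto π₀ hπ₀).toContinuousLinearMap with hπ
  have hπV : ∀ v : V, π v = v := fun v ↦ Submodule.projectionOnto_apply_left hπ₀ v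
  -- Keeping only the `V`-component of `T` turns `(S, T)` into a submersion at `e`, whose fibres
  -- contain curves with velocity `w`. The rank hypothesis then shows that the discarded component
  -- of `T` does not move along such a curve.
  set Ψ : E → A × V := fun u ↦ (S u, π (T u)) with hΨ
  have hΨ' : ContDiffAt ℝ ∞ Ψ e := hS.prodMk (π.contDiff.contDiffAt.comp e hT)
  have hΨd : ∀ u, DifferentiableAt ℝ S u → DifferentiableAt ℝ T u →
      fderiv ℝ Ψ u = (fderiv ℝ S u).prod (π.comp (fderiv ℝ T u)) := fun u h1 h2 ↦
    (h1.hasFDerivAt.prodMk (π.hasFDerivAt.comp u h2.hasFDerivAt)).fderiv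
  have hΨe := hΨd e (hS.differentiableAt (by simp)) (hT.differentiableAt (by simp))
  have hΨs : Function.Surjective (fderiv ℝ Ψ e) := by
    rintro ⟨a, v⟩
    obtain ⟨u, rfl⟩ := hsurj a
    obtain ⟨y, hy, hyv⟩ := (v - π (fderiv ℝ T e u)).2
    refine ⟨u + y, ?_⟩
    rw [hΨe]
    have hy' : fderiv ℝ S e y = 0 := hy
    have hyv' : fderiv ℝ T e y = ((v - π (fderiv ℝ T e u) : V) : B) := hyv
    refine Prod.ext ?_ ?_
    · simp [hy']
    · change π (fderiv ℝ T e (u + y)) = v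
      rw [map_add, map_add, hyv', hπV, add_sub_cancel]
  obtain ⟨c, hc, hc0, hcw, hcΨ⟩ := hΨ'.exists_curve_of_surjective hΨs (w := w)
    (by rw [hΨe]; simp [hw, hw'])
  refine ⟨c, hc, hc0, hcw, ?_⟩
  have hce : Filter.Tendsto c (𝓝 0) (𝓝 e) := hc0 ▸ hc.continuousAt
  have k1 : ∀ᶠ τ in 𝓝 (0 : ℝ), DifferentiableAt ℝ c τ := by
    filter_upwards [(hc.of_le (m := 1) (by simp)).eventually (by simp)] with τ h
    exact h.differentiableAt (by simp)
  have k2 : ∀ᶠ u in 𝓝 e, DifferentiableAt ℝ S u := by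
    filter_upwards [(hS.of_le (m := 1) (by simp)).eventually (by simp)] with τ h
    exact h.differentiableAt (by simp)
  have k3 : ∀ᶠ u in 𝓝 e, DifferentiableAt ℝ T u := by
    filter_upwards [(hT.of_le (m := 1) (by simp)).eventually (by simp)] with τ h
    exact h.differentiableAt (by simp)
  have key : ∀ᶠ τ in 𝓝 (0 : ℝ), HasDerivAt (fun τ ↦ T (c τ)) 0 τ := by
    filter_upwards [k1, hce.eventually k2, hce.eventually k3, hcΨ.eventually_nhds,
      hce.eventually (hΨ'.eventually_surjective_fderiv hΨs), hce.eventually hrank]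
      with τ h1 h2 h3 h4 h5 h6
    have hSc : S (c τ) = S e := congrArg Prod.fst h4.self_of_nhds
    have h7' : HasFDerivAt Ψ (fderiv ℝ Ψ (c τ)) (c τ) := by
      rw [hΨd _ h2 h3]
      exact h2.hasFDerivAt.prodMk (π.hasFDerivAt.comp (c τ) h3.hasFDerivAt)
    have h7 : HasDerivAt (fun τ ↦ Ψ (c τ)) (fderiv ℝ Ψ (c τ) (deriv c τ)) τ :=
      h7'.comp_hasDerivAt τ h1.hasDerivAt
    have h8 : fderiv ℝ Ψ (c τ) (deriv c τ) = 0 :=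
      h7.unique ((hasDerivAt_const τ (Ψ e)).congr_of_eventuallyEq h4)
    have h9 := h3.hasFDerivAt.comp_hasDerivAt τ h1.hasDerivAt
    rw [hΨd _ h2 h3] at h8 h5
    have hs0 : fderiv ℝ S (c τ) (deriv c τ) = 0 := congrArg Prod.fst h8
    have ht0 : π (fderiv ℝ T (c τ) (deriv c τ)) = 0 := congrArg Prod.snd h8
    set W := (LinearMap.ker (fderiv ℝ S (c τ)).toLinearMap).map (fderiv ℝ T (c τ)).toLinearMap
    have hsur : Function.Surjective (π.toLinearMap.domRestrict W) := by
      intro v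
      obtain ⟨y, hy⟩ := h5 (0, v)
      exact ⟨⟨_, y, congrArg Prod.fst hy, rfl⟩, congrArg Prod.snd hy⟩
    -- Near `e` the map `Ψ` is still a submersion, so `π` sends `W` onto `V`. The rank bound then
    -- makes it injective on `W`. The velocity of `T ∘ c` lies in `W`, because `dS` kills `c'`, and
    -- is killed by `π`, so it vanishes.
    have hfr : Module.finrank ℝ W = Module.finrank ℝ V :=
      le_antisymm (h6 hSc) (LinearMap.finrank_le_finrank_of_surjective hsur)
    have hinj := (LinearMap.injective_iff_surjective_of_finrank_eq_finrank hfr).2 hsur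
    have hz : (⟨fderiv ℝ T (c τ) (deriv c τ), deriv c τ, hs0, rfl⟩ : W) = 0 :=
      hinj ((show _ = (0 : V) from ht0).trans (map_zero _).symm)
    have hz' : fderiv ℝ T (c τ) (deriv c τ) = 0 := congrArg Subtype.val hz
    rw [hz'] at h9
    exact h9
  obtain ⟨ε, hε, hball⟩ := Metric.eventually_nhds_iff_ball.1 key
  filter_upwards [hcΨ, Metric.ball_mem_nhds (0 : ℝ) hε] with τ h1 h2
  refine ⟨congrArg Prod.fst h1, ?_⟩
  have := Metric.isOpen_ball.is_const_of_deriv_eq_zero (convex_ball (0 : ℝ) ε).isPreconnected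
    (fun y hy ↦ (hball y hy).differentiableAt.differentiableWithinAt)
    (fun y hy ↦ (hball y hy).deriv) h2 (Metric.mem_ball_self hε)
  rw [this, hc0]

end ConstantRank

/-! ### A criterion for good pullbacks -/

section Criterion

variable {EP HP P E₁ H₁ M₁ E₂ H₂ M₂ E H M : Type*}
  [NormedAddCommGroup EP] [NormedSpace ℝ EP] [FiniteDimensional ℝ EP]
  [TopologicalSpace HP] [TopologicalSpace P] [ChartedSpace HP P]
  [NormedAddCommGroup E₁] [NormedSpace ℝ E₁] [FiniteDimensional ℝ E₁]
  [TopologicalSpace H₁] [TopologicalSpace M₁] [ChartedSpace H₁ M₁]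
  [NormedAddCommGroup E₂] [NormedSpace ℝ E₂] [FiniteDimensional ℝ E₂]
  [TopologicalSpace H₂] [TopologicalSpace M₂] [ChartedSpace H₂ M₂]
  [NormedAddCommGroup E] [NormedSpace ℝ E] [FiniteDimensional ℝ E]
  [TopologicalSpace H] [TopologicalSpace M] [ChartedSpace H M]
  {IP : ModelWithCorners ℝ EP HP} [IP.Boundaryless] [IsManifold IP ∞ P]
  {I₁ : ModelWithCorners ℝ E₁ H₁} [I₁.Boundaryless] [IsManifold I₁ ∞ M₁]
  {I₂ : ModelWithCorners ℝ E₂ H₂} [I₂.Boundaryless] [IsManifold I₂ ∞ M₂]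
  {I : ModelWithCorners ℝ E H} [IsManifold I ∞ M]
  {p₁ : P → M₁} {p₂ : P → M₂} {f₁ : M₁ → M} {f₂ : M₂ → M}

omit [I₁.Boundaryless] [IsManifold I₁ ∞ M₁] [I₂.Boundaryless] [IsManifold I₂ ∞ M₂] in
/-- A pair of smooth maps with jointly injective differentials has a smooth local retraction. -/
theorem exists_leftInverse_prodMk {p : P} (hp₁ : ContMDiffAt IP I₁ ∞ p₁ p)
    (hp₂ : ContMDiffAt IP I₂ ∞ p₂ p)
    (hinj : ∀ u, modelDeriv IP I₁ p₁ p u = 0 → modelDeriv IP I₂ p₂ p u = 0 → u = 0) :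
    ∃ r : M₁ × M₂ → P, ContMDiffAt (I₁.prod I₂) IP ∞ r (p₁ p, p₂ p) ∧
      ∀ᶠ q in 𝓝 p, r (p₁ q, p₂ q) = q := by
  refine ContMDiffAt.exists_leftInverse (hp₁.prodMk hp₂) ?_
  rw [modelDeriv_prodMk (hp₁.mdifferentiableAt (by simp)) (hp₂.mdifferentiableAt (by simp))]
  rw [injective_iff_map_eq_zero]
  intro u hu
  exact hinj u (congrArg Prod.fst hu) (congrArg Prod.snd hu)

/-- A commutative square with exact tangent sequence at `p` covers a neighbourhood of the image of
`p` in the fibre product. -/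
theorem eventually_exists_of_exact {p : P} (hp₁ : ContMDiffAt IP I₁ ∞ p₁ p)
    (hp₂ : ContMDiffAt IP I₂ ∞ p₂ p) (hf₁ : ContMDiffAt I₁ I ∞ f₁ (p₁ p))
    (hf₂ : ContMDiffAt I₂ I ∞ f₂ (p₂ p)) (comm : ∀ q, f₁ (p₁ q) = f₂ (p₂ q))
    (hinj : ∀ u, modelDeriv IP I₁ p₁ p u = 0 → modelDeriv IP I₂ p₂ p u = 0 → u = 0)
    (hex : ∀ v w, modelDeriv I₁ I f₁ (p₁ p) v = modelDeriv I₂ I f₂ (p₂ p) w →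
      ∃ u, modelDeriv IP I₁ p₁ p u = v ∧ modelDeriv IP I₂ p₂ p u = w)
    {U : Set P} (hU : U ∈ 𝓝 p) :
    ∀ᶠ q in 𝓝 (p₁ p, p₂ p), f₁ q.1 = f₂ q.2 → ∃ p' ∈ U, (p₁ p', p₂ p') = q := by
  obtain ⟨r, hr, hrp⟩ := exists_leftInverse_prodMk hp₁ hp₂ hinj
  obtain ⟨Θ, hΘ, hΘ0, hΘd⟩ := exists_localDifference (comm p) hf₁ hf₂
  have hF : ContMDiffAt IP (I₁.prod I₂) ∞ (fun q ↦ (p₁ q, p₂ q)) p := hp₁.prodMk hp₂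
  have hrp0 : r (p₁ p, p₂ p) = p := hrp.self_of_nhds
  have hrd : ∀ u, modelDeriv (I₁.prod I₂) IP r (p₁ p, p₂ p)
      (modelDeriv IP I₁ p₁ p u, modelDeriv IP I₂ p₂ p u) = u := by
    intro u
    have h1 := modelDeriv_comp (F := fun q ↦ (p₁ q, p₂ q)) (y := (p₁ p, p₂ p)) rfl (hr.mdifferentiableAt (by simp))
      (hF.mdifferentiableAt (by simp))
    have h2 : modelDeriv IP IP (fun q ↦ r (p₁ q, p₂ q)) p = modelDeriv IP IP id p :=
      modelDeriv_congr hrp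
    have h3 : modelDeriv IP IP (id : P → P) p = ContinuousLinearMap.id ℝ EP := mfderiv_id
    rw [h2, h3, modelDeriv_prodMk (hp₁.mdifferentiableAt (by simp))
      (hp₂.mdifferentiableAt (by simp))] at h1
    exact congrArg (fun L : EP →L[ℝ] EP ↦ L u) h1.symm
  -- A vector killed by `dΘ` comes from some `u` in `T P` by exactness, and `dr` recovers `u`. Hence
  -- `(Θ, r)` is injective near the point.
  have hΨ : Function.Injective (modelDeriv (I₁.prod I₂) (𝓘(ℝ, E).prod IP) (fun q ↦ (Θ q, r q))
      (p₁ p, p₂ p)) := by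
    rw [modelDeriv_prodMk (hΘ.mdifferentiableAt (by simp)) (hr.mdifferentiableAt (by simp)),
      injective_iff_map_eq_zero]
    rintro ⟨v, w⟩ hvw
    have h1 := hΘd v w
    have h2 : modelDeriv (I₁.prod I₂) 𝓘(ℝ, E) Θ (p₁ p, p₂ p) (v, w) = 0 := congrArg Prod.fst hvw
    have h3 : modelDeriv (I₁.prod I₂) IP r (p₁ p, p₂ p) (v, w) = 0 := congrArg Prod.snd hvw
    rw [h2] at h1
    obtain ⟨u, rfl, rfl⟩ := hex v w (sub_eq_zero.1 h1.symm)
    rw [hrd] at h3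
    rw [h3, map_zero, map_zero]
    rfl
  obtain ⟨ρ, -, hρ⟩ := (hΘ.prodMk hr).exists_leftInverse hΨ
  have hrt : Filter.Tendsto r (𝓝 (p₁ p, p₂ p)) (𝓝 p) := by
    have := hr.continuousAt.tendsto
    rwa [hrp0] at this
  have hFt := hF.continuousAt.tendsto
  filter_upwards [hΘ0, hρ, hrt hU, hrt.eventually hrp, (hFt.comp hrt).eventually hΘ0,
    (hFt.comp hrt).eventually hρ] with q h1 h2 h3 h4 h5 h6 hq
  -- For `q` in the fibre product, `q` and the image of `r q` have the same value `0` under `Θ` and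
  -- the same value `r q` under `r`. Since `(Θ, r)` is locally injective, they coincide.
  refine ⟨r q, h3, ?_⟩
  have h7 : Θ (p₁ (r q), p₂ (r q)) = 0 := h5.2 (comm _)
  have h8 : ρ (Θ (p₁ (r q), p₂ (r q)), r (p₁ (r q), p₂ (r q))) = (p₁ (r q), p₂ (r q)) := h6
  rw [← h8, h7, h4, ← h1.2 hq]
  exact h2

/-- A commutative square of smooth maps which is a pullback of sets and of tangent spaces is a good
pullback. -/
theorem isGoodPullback_of_bijective (hp₁ : ContMDiff IP I₁ ∞ p₁) (hp₂ : ContMDiff IP I₂ ∞ p₂)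
    (hf₁ : ContMDiff I₁ I ∞ f₁) (hf₂ : ContMDiff I₂ I ∞ f₂) (comm : ∀ p, f₁ (p₁ p) = f₂ (p₂ p))
    (hbij : Set.BijOn (fun p ↦ (p₁ p, p₂ p)) Set.univ (fiberProduct f₁ f₂))
    (hinj : ∀ p u, modelDeriv IP I₁ p₁ p u = 0 → modelDeriv IP I₂ p₂ p u = 0 → u = 0)
    (hex : ∀ p v w, modelDeriv I₁ I f₁ (p₁ p) v = modelDeriv I₂ I f₂ (p₂ p) w →
      ∃ u, modelDeriv IP I₁ p₁ p u = v ∧ modelDeriv IP I₂ p₂ p u = w) :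
    IsGoodPullback.{w} IP I₁ I₂ I p₁ p₂ f₁ f₂ := by
  have hhom : IsHomeomorph (fun p ↦ (⟨(p₁ p, p₂ p), comm p⟩ : fiberProduct f₁ f₂)) := by
    refine ⟨(hp₁.continuous.prodMk hp₂.continuous).subtype_mk _, ?_, ?_, ?_⟩
    · rw [isOpenMap_iff_nhds_le]
      intro p U hU
      refine (mem_nhds_subtype _ _ _).2 ⟨_, eventually_exists_of_exact (hp₁ p) (hp₂ p) (hf₁ _) (hf₂ _) comm (hinj p) (hex p)
        (Filter.mem_map.1 hU), ?_⟩
      rintro ⟨q, hq⟩ h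
      obtain ⟨p', hp', rfl⟩ := h hq
      exact hp'
    · intro p q hpq
      exact hbij.injOn (Set.mem_univ _) (Set.mem_univ _) (congrArg Subtype.val hpq)
    · rintro ⟨q, hq⟩
      obtain ⟨p, -, rfl⟩ := hbij.surjOn hq
      exact ⟨p, rfl⟩
  refine ⟨hp₁, hp₂, hf₁, hf₂, comm, ?_, hhom, ?_⟩
  · intro d Z _ _ _ _ _ a b ha hb hab
    set Φ := hhom.homeomorph
    have hab' : Continuous (fun z ↦ (⟨(a z, b z), hab z⟩ : fiberProduct f₁ f₂)) :=
      (ha.continuous.prodMk hb.continuous).subtype_mk _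
    set c : Z → P := fun z ↦ Φ.symm ⟨(a z, b z), hab z⟩ with hc
    have hcc : Continuous c := Φ.symm.continuous.comp hab'
    have hcz : ∀ z, (p₁ (c z), p₂ (c z)) = (a z, b z) := fun z ↦
      congrArg Subtype.val (Φ.apply_symm_apply ⟨(a z, b z), hab z⟩)
    refine ⟨c, ⟨fun z ↦ ?_, fun z ↦ congrArg Prod.fst (hcz z), fun z ↦ congrArg Prod.snd (hcz z)⟩,
      ?_⟩
    -- The homeomorphism gives a continuous lift `c`. Continuity keeps it where `r` is a retraction,
    -- so locally `c` equals `r ∘ (a, b)` and is smooth.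
    · obtain ⟨r, hr, hrp⟩ := exists_leftInverse_prodMk (hp₁ (c z)) (hp₂ (c z)) (hinj (c z))
      rw [hcz] at hr
      have h1 : ContMDiffAt (𝓡 d) IP ∞ (fun z ↦ r (a z, b z)) z :=
        ContMDiffAt.comp z hr ((ha z).prodMk (hb z))
      refine h1.congr_of_eventuallyEq ?_
      filter_upwards [hcc.continuousAt.eventually hrp] with z' hz'
      rw [← hcz, hz']
    · rintro c' ⟨-, h1, h2⟩
      funext z
      apply hbij.injOn (Set.mem_univ _) (Set.mem_univ _)
      exact (Prod.ext (h1 z) (h2 z)).trans (hcz z).symm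
  · intro p
    refine ⟨?_, ?_, ?_⟩
    · intro u _
      have h1 := modelDeriv_comp (y := p₁ p) rfl ((hf₁ _).mdifferentiableAt (by simp))
        ((hp₁ p).mdifferentiableAt (by simp))
      have h2 := modelDeriv_comp (y := p₂ p) rfl ((hf₂ _).mdifferentiableAt (by simp))
        ((hp₂ p).mdifferentiableAt (by simp))
      rw [funext comm, h2] at h1
      exact congrArg (fun L : EP →L[ℝ] E ↦ L u) h1.symm
    · intro u _ v _ huv
      have h1 : modelDeriv IP I₁ p₁ p u = modelDeriv IP I₁ p₁ p v := congrArg Prod.fst huv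
      have h2 : modelDeriv IP I₂ p₂ p u = modelDeriv IP I₂ p₂ p v := congrArg Prod.snd huv
      have h3 := hinj p (show EP from u - v) ((map_sub (modelDeriv IP I₁ p₁ p) u v).trans
        (sub_eq_zero.2 h1)) ((map_sub (modelDeriv IP I₂ p₂ p) u v).trans (sub_eq_zero.2 h2))
      exact sub_eq_zero.1 h3
    · rintro ⟨v, w⟩ hvw
      obtain ⟨u, hu1, hu2⟩ := hex p v w hvw
      exact ⟨u, Set.mem_univ _, Prod.ext hu1 hu2⟩

end Criterion

/-! ### Tangent exactness extracted from a good pullback -/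

section Consequences

variable {EP HP P E₁ H₁ M₁ E₂ H₂ M₂ E H M : Type*}
  [NormedAddCommGroup EP] [NormedSpace ℝ EP] [TopologicalSpace HP] [TopologicalSpace P]
  [ChartedSpace HP P]
  [NormedAddCommGroup E₁] [NormedSpace ℝ E₁] [TopologicalSpace H₁] [TopologicalSpace M₁]
  [ChartedSpace H₁ M₁]
  [NormedAddCommGroup E₂] [NormedSpace ℝ E₂] [TopologicalSpace H₂] [TopologicalSpace M₂]
  [ChartedSpace H₂ M₂]
  [NormedAddCommGroup E] [NormedSpace ℝ E] [TopologicalSpace H] [TopologicalSpace M]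
  [ChartedSpace H M]
  {IP : ModelWithCorners ℝ EP HP} {I₁ : ModelWithCorners ℝ E₁ H₁} {I₂ : ModelWithCorners ℝ E₂ H₂}
  {I : ModelWithCorners ℝ E H} {p₁ : P → M₁} {p₂ : P → M₂} {f₁ : M₁ → M} {f₂ : M₂ → M}

theorem IsGoodPullback.eq_zero_of_modelDeriv (h : IsGoodPullback.{w} IP I₁ I₂ I p₁ p₂ f₁ f₂)
    {p : P} {u : EP} (h₁ : modelDeriv IP I₁ p₁ p u = 0) (h₂ : modelDeriv IP I₂ p₂ p u = 0) :
    u = 0 :=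
  (h.tangent p).injOn (Set.mem_univ u) (Set.mem_univ (0 : EP)) <| Prod.ext
    (h₁.trans (map_zero (modelDeriv IP I₁ p₁ p)).symm)
    (h₂.trans (map_zero (modelDeriv IP I₂ p₂ p)).symm)

theorem IsGoodPullback.exists_modelDeriv (h : IsGoodPullback.{w} IP I₁ I₂ I p₁ p₂ f₁ f₂)
    {p : P} {v : E₁} {w : E₂}
    (hvw : modelDeriv I₁ I f₁ (p₁ p) v = modelDeriv I₂ I f₂ (p₂ p) w) :
    ∃ u, modelDeriv IP I₁ p₁ p u = v ∧ modelDeriv IP I₂ p₂ p u = w := by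
  obtain ⟨u, -, hu⟩ := (h.tangent p).surjOn (a := (v, w)) hvw
  exact ⟨u, congrArg Prod.fst hu, congrArg Prod.snd hu⟩

end Consequences

/-! ### Curves in the sets of arrows between two objects -/

section Velocity

variable {E H P E' H' N E'' H'' Q : Type*}
  [NormedAddCommGroup E] [NormedSpace ℝ E] [TopologicalSpace H]
  [TopologicalSpace P] [ChartedSpace H P]
  [NormedAddCommGroup E'] [NormedSpace ℝ E'] [TopologicalSpace H']
  [TopologicalSpace N] [ChartedSpace H' N]
  [NormedAddCommGroup E''] [NormedSpace ℝ E''] [TopologicalSpace H'']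
  [TopologicalSpace Q] [ChartedSpace H'' Q]
  {I : ModelWithCorners ℝ E H} {J : ModelWithCorners ℝ E' H'} {K : ModelWithCorners ℝ E'' H''}

/-- Differentiates along curves inside a set such as an isotropy group, without requiring
derivatives within it to be unique. One `L`, depending only on `g`, `T` and `y`, serves every `F`.
-/
theorem MDifferentiableWithinAt.exists_comp_modelDeriv {T : Set N} {g : N → Q} {y : N}
    (hg : MDifferentiableWithinAt J K g T y) :
    ∃ L : E' →L[ℝ] E'', ∀ (F : P → N) (x : P), F x = y → MDifferentiableAt I J F x →
      (∀ᶠ z in 𝓝 x, F z ∈ T) → MDifferentiableAt I K (fun z ↦ g (F z)) x ∧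
        modelDeriv I K (fun z ↦ g (F z)) x = L.comp (modelDeriv I J F x) := by
  refine ⟨mfderivWithin J K g T y, ?_⟩
  rintro F x rfl hF hT
  have h1 := (hg.hasMFDerivWithinAt.comp (s := F ⁻¹' T) x hF.hasMFDerivAt.hasMFDerivWithinAt
    subset_rfl).hasMFDerivAt hT
  exact ⟨h1.mdifferentiableAt, h1.mfderiv⟩

theorem modelDeriv_of_eventually_const {F : P → N} {x : P} {y : N} (h : ∀ᶠ z in 𝓝 x, F z = y) :
    modelDeriv I J F x = 0 := by
  have h1 : modelDeriv I J F x = modelDeriv I J (fun _ ↦ y) x := modelDeriv_congr h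
  rw [h1]
  exact mfderiv_const

end Velocity

namespace LieGroupoid

variable {m k : ℕ} {M G : Type*}
  [TopologicalSpace M] [ChartedSpace (EuclideanSpace ℝ (Fin m)) M]
  [TopologicalSpace G] [ChartedSpace (EuclideanSpace ℝ (Fin k)) G]
  (𝒢 : LieGroupoid m k M G)

theorem inv_mul_cancel_left {g a : G} (h : 𝒢.src g = 𝒢.tgt a) :
    𝒢.mul (𝒢.inv g) (𝒢.mul g a) = a := by
  rw [← 𝒢.mul_assoc _ _ _ (𝒢.src_inv g) h, 𝒢.inv_mul, h, 𝒢.one_mul]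

theorem mul_inv_cancel_left {g a : G} (h : 𝒢.tgt g = 𝒢.tgt a) :
    𝒢.mul g (𝒢.mul (𝒢.inv g) a) = a := by
  rw [← 𝒢.mul_assoc _ _ _ (𝒢.tgt_inv g).symm ((𝒢.src_inv g).trans h), 𝒢.mul_inv, h, 𝒢.one_mul]

theorem inv_inv (g : G) : 𝒢.inv (𝒢.inv g) = g := by
  have h := 𝒢.inv_mul_cancel_left (g := 𝒢.inv g) (a := g) (𝒢.src_inv g)
  rw [𝒢.inv_mul, ← 𝒢.tgt_inv g, ← 𝒢.src_inv (𝒢.inv g), 𝒢.mul_one] at h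
  exact h

theorem src_smooth : ContMDiff (𝓡 k) (𝓡 m) ∞ 𝒢.src := fun g ↦ 𝒢.src_contMDiffAt g

theorem tgt_smooth : ContMDiff (𝓡 k) (𝓡 m) ∞ 𝒢.tgt := fun g ↦ 𝒢.tgt_contMDiffAt g

/-- The tangent space of the orbit, as a subspace of the model space. -/
noncomputable def orbitDirections (x : M) : Submodule ℝ (EuclideanSpace ℝ (Fin m)) := 𝒢.orbitTangent x

variable [IsManifold (𝓡 m) ∞ M] [IsManifold (𝓡 k) ∞ G]

theorem dtgt_surjective (g : G) : Function.Surjective (𝒢.dtgt g) := fun v ↦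
  (𝒢.tgt_submersion.isSubmersionAt g).exists_mfderiv_eq v

/-- An orbit direction at the target lifts to a vector killed by `ds`. -/
theorem exists_lift_orbitTangent_tgt {g : G} {v : EuclideanSpace ℝ (Fin m)}
    (hv : v ∈ 𝒢.orbitTangent (𝒢.tgt g)) : ∃ w, 𝒢.dsrc g w = 0 ∧ 𝒢.dtgt g w = v := by
  obtain ⟨u, hu1, hu2⟩ := 𝒢.exists_lift_orbitTangent (𝒢.src_inv g) hv
  obtain ⟨w, hw1, hw2⟩ := 𝒢.exists_inv_tangent (𝒢.inv g) u
  rw [𝒢.inv_inv] at hw1 hw2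
  exact ⟨w, hw1.trans hu2, hw2.trans hu1⟩

/-- Makes the rank of `t` along a source fibre equal to the dimension of the orbit, at every arrow
and not only at units. -/
theorem map_ker_dsrc (g : G) :
    (LinearMap.ker (𝒢.dsrc g)).map (𝒢.dtgt g) = 𝒢.orbitDirections (𝒢.tgt g) := by
  apply le_antisymm
  · rintro _ ⟨w, hw, rfl⟩
    exact 𝒢.dtgt_mem_orbitTangent rfl hw
  · intro v hv
    exact 𝒢.exists_lift_orbitTangent_tgt hv

theorem normalAction_surjective (g : G) :
    Function.Surjective (𝒢.normalAction g rfl rfl) := by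
  intro n
  obtain ⟨v, rfl⟩ := Submodule.mkQ_surjective _ n
  obtain ⟨w, hw⟩ := 𝒢.dtgt_surjective g v
  refine ⟨𝒢.srcNormal g rfl w, ?_⟩
  rw [𝒢.normalAction_srcNormal]
  exact congrArg (𝒢.orbitTangent (𝒢.tgt g)).mkQ hw

/-- The normal action of `g` maps the normal space at its source onto that at its target, so the
codimension of the orbit cannot grow from source to target. The inverse arrow gives the opposite
inequality. -/
theorem finrank_orbitDirections_le (g : G) :
    Module.finrank ℝ (𝒢.orbitDirections (𝒢.src g)) ≤
      Module.finrank ℝ (𝒢.orbitDirections (𝒢.tgt g)) := by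
  have h1 := (𝒢.orbitDirections (𝒢.src g)).finrank_quotient_add_finrank
  have h2 := (𝒢.orbitDirections (𝒢.tgt g)).finrank_quotient_add_finrank
  have h3 : Module.finrank ℝ (EuclideanSpace ℝ (Fin m) ⧸ 𝒢.orbitDirections (𝒢.tgt g)) ≤
      Module.finrank ℝ (EuclideanSpace ℝ (Fin m) ⧸ 𝒢.orbitDirections (𝒢.src g)) :=
    LinearMap.finrank_le_finrank_of_surjective (f := (𝒢.normalAction g rfl rfl :
      (EuclideanSpace ℝ (Fin m) ⧸ 𝒢.orbitDirections (𝒢.src g)) →ₗ[ℝ]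
        EuclideanSpace ℝ (Fin m) ⧸ 𝒢.orbitDirections (𝒢.tgt g))) (𝒢.normalAction_surjective g)
  omega

theorem finrank_orbitDirections_eq (g : G) :
    Module.finrank ℝ (𝒢.orbitDirections (𝒢.tgt g)) =
      Module.finrank ℝ (𝒢.orbitDirections (𝒢.src g)) := by
  apply le_antisymm _ (𝒢.finrank_orbitDirections_le g)
  have h := 𝒢.finrank_orbitDirections_le (𝒢.inv g)
  rwa [𝒢.src_inv, 𝒢.tgt_inv] at h

/-- A vector killed by `ds` and `dt` is the velocity of a curve of arrows with fixed source and
target. -/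
theorem exists_curve_of_dsrc_of_dtgt {g : G} {w : EuclideanSpace ℝ (Fin k)}
    (hs : 𝒢.dsrc g w = 0) (ht : 𝒢.dtgt g w = 0) :
    ∃ c : ℝ → G, MDifferentiableAt 𝓘(ℝ, ℝ) (𝓡 k) c 0 ∧ c 0 = g ∧
      modelDeriv 𝓘(ℝ, ℝ) (𝓡 k) c 0 1 = w ∧
      ∀ᶠ τ in 𝓝 (0 : ℝ), 𝒢.src (c τ) = 𝒢.src g ∧ 𝒢.tgt (c τ) = 𝒢.tgt g := by
  obtain ⟨hS, hS'⟩ := (𝒢.src_contMDiffAt g).hasFDerivAt_writtenInExtChartAt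
  obtain ⟨hT, hT'⟩ := (𝒢.tgt_contMDiffAt g).hasFDerivAt_writtenInExtChartAt
  set χ := extChartAt (𝓡 k) g with hχ
  set ζ := extChartAt (𝓡 m) (𝒢.src g) with hζ
  set ξ := extChartAt (𝓡 m) (𝒢.tgt g) with hξ
  set S := writtenInExtChartAt (𝓡 k) (𝓡 m) g 𝒢.src
  set T := writtenInExtChartAt (𝓡 k) (𝓡 m) g 𝒢.tgt
  have hχg : χ.symm (χ g) = g := extChartAt_to_inv g
  have hS0 : S (χ g) = ζ (𝒢.src g) := by
    change ζ (𝒢.src (χ.symm (χ g))) = _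
    rw [hχg]
  have hT0 : T (χ g) = ξ (𝒢.tgt g) := by
    change ξ (𝒢.tgt (χ.symm (χ g))) = _
    rw [hχg]
  have hsymm : ContinuousAt χ.symm (χ g) := continuousAt_extChartAt_symm g
  have n1 : ∀ᶠ e in 𝓝 (χ g), e ∈ χ.target := extChartAt_target_mem_nhds g
  have n2 : ∀ᶠ e in 𝓝 (χ g), 𝒢.src (χ.symm e) ∈ ζ.source := by
    have : ContinuousAt (fun e ↦ 𝒢.src (χ.symm e)) (χ g) :=
      𝒢.src_smooth.continuous.continuousAt.comp hsymm
    apply this.eventually_mem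
    rw [hχg]
    exact extChartAt_source_mem_nhds _
  have n3 : ∀ᶠ e in 𝓝 (χ g), 𝒢.tgt (χ.symm e) ∈ ξ.source := by
    have : ContinuousAt (fun e ↦ 𝒢.tgt (χ.symm e)) (χ g) :=
      𝒢.tgt_smooth.continuous.continuousAt.comp hsymm
    apply this.eventually_mem
    rw [hχg]
    exact extChartAt_source_mem_nhds _
  have hr0 : (LinearMap.ker (fderiv ℝ S (χ g)).toLinearMap).map (fderiv ℝ T (χ g)).toLinearMap =
      𝒢.orbitDirections (𝒢.tgt g) := by
    rw [hS'.fderiv, hT'.fderiv]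
    exact 𝒢.map_ker_dsrc g
  have hrank : ∀ᶠ e in 𝓝 (χ g), S e = S (χ g) →
      Module.finrank ℝ ((LinearMap.ker (fderiv ℝ S e).toLinearMap).map
          (fderiv ℝ T e).toLinearMap) ≤
        Module.finrank ℝ ((LinearMap.ker (fderiv ℝ S (χ g)).toLinearMap).map
          (fderiv ℝ T (χ g)).toLinearMap) := by
    filter_upwards [n1, n2, n3] with e h1 h2 h3 he
    have hsrc : 𝒢.src (χ.symm e) = 𝒢.src g := by
      apply ζ.injOn h2 (mem_extChartAt_source _)
      rw [← hS0, ← he]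
      rfl
    have d1 : MDifferentiableAt (𝓡 k) (𝓡 k) χ.symm e :=
      ((contMDiffOn_extChartAt_symm (n := ∞) g).contMDiffAt
        ((isOpen_extChartAt_target g).mem_nhds h1)).mdifferentiableAt (by simp)
    have d2 : MDifferentiableAt (𝓡 m) (𝓡 m) ξ (𝒢.tgt (χ.symm e)) :=
      (contMDiffAt_extChartAt' (n := ∞) (by simpa [hξ] using h3)).mdifferentiableAt (by simp)
    have d3 : MDifferentiableAt (𝓡 m) (𝓡 m) ζ (𝒢.src (χ.symm e)) :=
      (contMDiffAt_extChartAt' (n := ∞) (by simpa [hζ] using h2)).mdifferentiableAt (by simp)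
    have ds := (𝒢.src_contMDiffAt (χ.symm e)).mdifferentiableAt (n := ∞) (by simp)
    have dt := (𝒢.tgt_contMDiffAt (χ.symm e)).mdifferentiableAt (n := ∞) (by simp)
    have eS : fderiv ℝ S e = (modelDeriv (𝓡 m) (𝓡 m) ζ (𝒢.src (χ.symm e))).comp
        ((modelDeriv (𝓡 k) (𝓡 m) 𝒢.src (χ.symm e)).comp
          (modelDeriv (𝓡 k) (𝓡 k) χ.symm e)) := by
      rw [← modelDeriv_comp rfl ds d1,
        ← modelDeriv_comp (F := fun z ↦ 𝒢.src (χ.symm z)) rfl d3 (ds.comp e d1)]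
      exact modelDeriv_eq_fderiv.symm
    have eT : fderiv ℝ T e = (modelDeriv (𝓡 m) (𝓡 m) ξ (𝒢.tgt (χ.symm e))).comp
        ((modelDeriv (𝓡 k) (𝓡 m) 𝒢.tgt (χ.symm e)).comp
          (modelDeriv (𝓡 k) (𝓡 k) χ.symm e)) := by
      rw [← modelDeriv_comp rfl dt d1,
        ← modelDeriv_comp (F := fun z ↦ 𝒢.tgt (χ.symm z)) rfl d2 (dt.comp e d1)]
      exact modelDeriv_eq_fderiv.symm
    -- On the source fibre of `g` the chart `ζ` is evaluated at its own centre, so the kernel of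
    -- `dS` is exactly that of `ds` read through `χ.symm`.
    have hζid : modelDeriv (𝓡 m) (𝓡 m) ζ (𝒢.src (χ.symm e)) = ContinuousLinearMap.id ℝ _ := by
      rw [hsrc]
      exact mfderiv_extChartAt_self
    have hle : (LinearMap.ker (fderiv ℝ S e).toLinearMap).map (fderiv ℝ T e).toLinearMap ≤
        (𝒢.orbitDirections (𝒢.tgt (χ.symm e))).map
          (modelDeriv (𝓡 m) (𝓡 m) ξ (𝒢.tgt (χ.symm e))).toLinearMap := by
      rintro _ ⟨v, hv, rfl⟩
      rw [eT]
      refine ⟨_, ?_, rfl⟩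
      rw [← 𝒢.map_ker_dsrc]
      refine ⟨_, ?_, rfl⟩
      have hv' : fderiv ℝ S e v = 0 := hv
      rw [eS, hζid] at hv'
      exact hv'
    -- The targets of `g` and of `χ.symm e` lie in the orbit of their common source, so their orbit
    -- directions have equal dimension. The differential of `ξ` cannot increase it.
    rw [hr0, 𝒢.finrank_orbitDirections_eq g, ← hsrc, ← 𝒢.finrank_orbitDirections_eq]
    exact (Submodule.finrank_mono hle).trans (Submodule.finrank_map_le _ _)
  obtain ⟨y, hy, hy0, hyw, hyST⟩ := exists_curve_of_constant_rank hS hT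
    (by rw [hS'.fderiv]; exact 𝒢.dsrc_surjective g) hrank (w := w)
    (by rw [hS'.fderiv]; exact hs) (by rw [hT'.fderiv]; exact ht)
  -- The chart at `g` has identity differential at `g`, so the coordinate velocity `w` is the
  -- velocity of the curve itself.
  have hch : (mfderiv (𝓡 k) (𝓡 k) (chartAt (EuclideanSpace ℝ (Fin k)) g) g w :
      EuclideanSpace ℝ (Fin k)) = w :=
    congrArg (fun L : EuclideanSpace ℝ (Fin k) →L[ℝ] EuclideanSpace ℝ (Fin k) ↦ L w)
      (mfderiv_extChartAt_self (I := 𝓡 k) (x := g))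
  obtain ⟨c1, c2, c3⟩ := velocity_of_chart (IsManifold.chart_mem_maximalAtlas g)
    (mem_chart_source _ g) hy hy0 w (hyw.deriv.trans hch.symm)
  refine ⟨_, c1.mdifferentiableAt (by simp), c2, c3, ?_⟩
  have hyt : Filter.Tendsto y (𝓝 0) (𝓝 (χ g)) := by
    have := hy.continuousAt.tendsto
    rwa [hy0] at this
  filter_upwards [hyST, hyt.eventually n2, hyt.eventually n3] with τ h1 h2 h3
  constructor
  · apply ζ.injOn h2 (mem_extChartAt_source _)
    rw [← hS0, ← h1.1]
    rfl
  · apply ξ.injOn h3 (mem_extChartAt_source _)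
    rw [← hT0, ← h1.2]
    rfl

end LieGroupoid

/-! ### Transferring velocities along maps that are diffeomorphisms on isotropy -/

namespace LieGroupoidHom

variable {m k m' k' : ℕ} {M G M' G' : Type*}
  [TopologicalSpace M] [ChartedSpace (EuclideanSpace ℝ (Fin m)) M]
  [TopologicalSpace G] [ChartedSpace (EuclideanSpace ℝ (Fin k)) G]
  [TopologicalSpace M'] [ChartedSpace (EuclideanSpace ℝ (Fin m')) M']
  [TopologicalSpace G'] [ChartedSpace (EuclideanSpace ℝ (Fin k')) G']
  {𝒢 : LieGroupoid m k M G} {𝒢' : LieGroupoid m' k' M' G'} (φ : LieGroupoidHom 𝒢 𝒢')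

/-- If `φ` is a diffeomorphism of isotropy groups at the source of `g`, then it has a smooth inverse
on the arrows which have the same source and target as `φ(g)`. -/
theorem exists_homInverse {g : G}
    (h : RestrictsToDiffeo (𝓡 k) (𝓡 k') φ.ar (𝒢.isotropySet (𝒢.src g))
      (𝒢'.isotropySet (φ.ob (𝒢.src g)))) :
    ∃ H : G' → G,
      ContMDiffOn (𝓡 k') (𝓡 k) ∞ H
        {a | 𝒢'.src a = φ.ob (𝒢.src g) ∧ 𝒢'.tgt a = φ.ob (𝒢.tgt g)} ∧
      (∀ a, 𝒢.src a = 𝒢.src g → 𝒢.tgt a = 𝒢.tgt g → H (φ.ar a) = a) ∧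
      ∀ a, 𝒢'.src a = φ.ob (𝒢.src g) → 𝒢'.tgt a = φ.ob (𝒢.tgt g) →
        𝒢.src (H a) = 𝒢.src g ∧ 𝒢.tgt (H a) = 𝒢.tgt g ∧ φ.ar (H a) = a := by
  obtain ⟨-, -, h, hinv, hmaps, hsm⟩ := h
  set D := 𝒢'.mul (𝒢'.inv (φ.ar g)) with hD
  have hcomp : ∀ a, 𝒢'.tgt a = φ.ob (𝒢.tgt g) → 𝒢'.src (𝒢'.inv (φ.ar g)) = 𝒢'.tgt a := by
    intro a ha
    rw [𝒢'.src_inv, φ.tgt_ar, ha]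
  have hDm : ∀ a, 𝒢'.src a = φ.ob (𝒢.src g) → 𝒢'.tgt a = φ.ob (𝒢.tgt g) →
      D a ∈ 𝒢'.isotropySet (φ.ob (𝒢.src g)) := by
    intro a h1 h2
    refine ⟨(𝒢'.src_mul _ _ (hcomp a h2)).trans h1, (𝒢'.tgt_mul _ _ (hcomp a h2)).trans ?_⟩
    rw [𝒢'.tgt_inv, φ.src_ar]
  have hhm : ∀ a, 𝒢'.src a = φ.ob (𝒢.src g) → 𝒢'.tgt a = φ.ob (𝒢.tgt g) →
      h (D a) ∈ 𝒢.isotropySet (𝒢.src g) := fun a h1 h2 ↦ hmaps (hDm a h1 h2)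
  -- Left translation by the inverse of `φ(g)` moves `a` into the isotropy group, where `h` inverts
  -- `φ`. Left translation by `g` brings the result back.
  refine ⟨fun a ↦ 𝒢.mul g (h (D a)), ?_, ?_, ?_⟩
  · have s1 : ContMDiffOn (𝓡 k') (𝓡 k') ∞ D
        {a | 𝒢'.src a = φ.ob (𝒢.src g) ∧ 𝒢'.tgt a = φ.ob (𝒢.tgt g)} :=
      ContMDiffOn.comp (f := fun a : G' ↦ (𝒢'.inv (φ.ar g), a)) 𝒢'.mul_smooth
        (contMDiffOn_const.prodMk contMDiffOn_id) (fun a ha ↦ hcomp a ha.2)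
    have s2 : ContMDiffOn (𝓡 k') (𝓡 k) ∞ (fun a ↦ h (D a))
        {a | 𝒢'.src a = φ.ob (𝒢.src g) ∧ 𝒢'.tgt a = φ.ob (𝒢.tgt g)} :=
      hsm.comp s1 (fun a ha ↦ hDm a ha.1 ha.2)
    exact ContMDiffOn.comp (f := fun a : G' ↦ (g, h (D a))) 𝒢.mul_smooth
        (contMDiffOn_const.prodMk s2) (fun a ha ↦ (hhm a ha.1 ha.2).2.symm)
  · intro a h1 h2
    have hc : 𝒢.src (𝒢.inv g) = 𝒢.tgt a := (𝒢.src_inv g).trans h2.symm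
    have hb : 𝒢.tgt (𝒢.mul (𝒢.inv g) a) = 𝒢.src g := by rw [𝒢.tgt_mul _ _ hc, 𝒢.tgt_inv]
    have hb' : 𝒢.src (𝒢.mul (𝒢.inv g) a) = 𝒢.src g := by rw [𝒢.src_mul _ _ hc, h1]
    have e1 : D (φ.ar a) = φ.ar (𝒢.mul (𝒢.inv g) a) := by
      conv_lhs => rw [← 𝒢.mul_inv_cancel_left h2.symm, φ.ar_mul _ _ hb.symm]
      apply 𝒢'.inv_mul_cancel_left
      rw [φ.src_ar, φ.tgt_ar, hb]
    change 𝒢.mul g (h (D (φ.ar a))) = a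
    rw [e1, hinv.1 ⟨hb', hb⟩, 𝒢.mul_inv_cancel_left h2.symm]
  · intro a h1 h2
    have hm := hhm a h1 h2
    refine ⟨(𝒢.src_mul _ _ hm.2.symm).trans hm.1, 𝒢.tgt_mul _ _ hm.2.symm, ?_⟩
    change φ.ar (𝒢.mul g (h (D a))) = a
    rw [φ.ar_mul _ _ hm.2.symm, hinv.2 (hDm a h1 h2), hD, 𝒢'.mul_inv_cancel_left]
    rw [φ.tgt_ar, h2]

variable [IsManifold (𝓡 m) ∞ M] [IsManifold (𝓡 k) ∞ G]

/-- Take a curve `c` of arrows with fixed end points and velocity `w`. Since `H ∘ φ ∘ c = c` near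
`0`, the vector `w` is a linear image of `dφ w = 0`. -/
theorem eq_zero_of_restrictsToDiffeo {g : G}
    (h : RestrictsToDiffeo (𝓡 k) (𝓡 k') φ.ar (𝒢.isotropySet (𝒢.src g))
      (𝒢'.isotropySet (φ.ob (𝒢.src g)))) {w : EuclideanSpace ℝ (Fin k)}
    (hs : 𝒢.dsrc g w = 0) (ht : 𝒢.dtgt g w = 0) (hφ : modelDeriv (𝓡 k) (𝓡 k') φ.ar g w = 0) :
    w = 0 := by
  obtain ⟨H, hH, hHφ, -⟩ := φ.exists_homInverse h
  obtain ⟨c, hc, hc0, hcw, hcst⟩ := 𝒢.exists_curve_of_dsrc_of_dtgt hs ht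
  have hmem : φ.ar g ∈ {a | 𝒢'.src a = φ.ob (𝒢.src g) ∧ 𝒢'.tgt a = φ.ob (𝒢.tgt g)} :=
    ⟨φ.src_ar g, φ.tgt_ar g⟩
  obtain ⟨L, hL⟩ := ((hH _ hmem).mdifferentiableWithinAt (by simp)).exists_comp_modelDeriv
    (I := 𝓘(ℝ, ℝ)) (P := ℝ)
  have hd : MDifferentiableAt (𝓡 k) (𝓡 k') φ.ar (c 0) := φ.ar_smooth.mdifferentiableAt (by simp)
  have hd' : MDifferentiableAt 𝓘(ℝ, ℝ) (𝓡 k') (fun τ ↦ φ.ar (c τ)) 0 := hd.comp 0 hc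
  obtain ⟨-, h2⟩ := hL (fun τ ↦ φ.ar (c τ)) 0 (by simp only [hc0]) hd' (by
    filter_upwards [hcst] with τ hτ
    exact ⟨by rw [φ.src_ar, hτ.1], by rw [φ.tgt_ar, hτ.2]⟩)
  have h3 : modelDeriv 𝓘(ℝ, ℝ) (𝓡 k) (fun τ ↦ H (φ.ar (c τ))) 0 =
      modelDeriv 𝓘(ℝ, ℝ) (𝓡 k) c 0 := by
    apply modelDeriv_congr
    filter_upwards [hcst] with τ hτ
    exact hHφ _ hτ.1 hτ.2
  have h4 := modelDeriv_comp hc0 (hc0 ▸ hd) hc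
  rw [← hcw, ← h3, h2]
  change L (modelDeriv 𝓘(ℝ, ℝ) (𝓡 k') (fun τ ↦ φ.ar (c τ)) 0 1) = 0
  rw [h4, ContinuousLinearMap.comp_apply, hcw, hφ, map_zero]

omit [IsManifold (𝓡 m) ∞ M] [IsManifold (𝓡 k) ∞ G] in
-- Take a curve `c` in `G'` with fixed end points and velocity `u`. The required vector is the
-- velocity of `H ∘ c`.
theorem exists_of_restrictsToDiffeo [IsManifold (𝓡 m') ∞ M'] [IsManifold (𝓡 k') ∞ G'] {g : G}
    (h : RestrictsToDiffeo (𝓡 k) (𝓡 k') φ.ar (𝒢.isotropySet (𝒢.src g))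
      (𝒢'.isotropySet (φ.ob (𝒢.src g)))) {u : EuclideanSpace ℝ (Fin k')}
    (hs : 𝒢'.dsrc (φ.ar g) u = 0) (ht : 𝒢'.dtgt (φ.ar g) u = 0) :
    ∃ w, 𝒢.dsrc g w = 0 ∧ 𝒢.dtgt g w = 0 ∧ modelDeriv (𝓡 k) (𝓡 k') φ.ar g w = u := by
  obtain ⟨H, hH, hHφ, hφH⟩ := φ.exists_homInverse h
  obtain ⟨c, hc, hc0, hcw, hcst⟩ := 𝒢'.exists_curve_of_dsrc_of_dtgt hs ht
  rw [φ.src_ar, φ.tgt_ar] at hcst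
  have hmem : φ.ar g ∈ {a | 𝒢'.src a = φ.ob (𝒢.src g) ∧ 𝒢'.tgt a = φ.ob (𝒢.tgt g)} :=
    ⟨φ.src_ar g, φ.tgt_ar g⟩
  obtain ⟨L, hL⟩ := ((hH _ hmem).mdifferentiableWithinAt (by simp)).exists_comp_modelDeriv
    (I := 𝓘(ℝ, ℝ)) (P := ℝ)
  obtain ⟨h1, -⟩ := hL c 0 hc0 hc hcst
  have h0 : H (c 0) = g := by rw [hc0, hHφ g rfl rfl]
  have es := modelDeriv_comp (F := fun τ ↦ H (c τ)) h0 ((𝒢.src_contMDiffAt g).mdifferentiableAt (by simp)) h1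
  have et := modelDeriv_comp (F := fun τ ↦ H (c τ)) h0 ((𝒢.tgt_contMDiffAt g).mdifferentiableAt (by simp)) h1
  have eφ := modelDeriv_comp (F := fun τ ↦ H (c τ)) h0 (φ.ar_smooth.mdifferentiableAt (by simp)) h1
  -- Near `0` the curve `H ∘ c` has constant source and target and is mapped to `c` by `φ`. The
  -- three chain rules become the three claims.
  rw [modelDeriv_of_eventually_const (y := 𝒢.src g)
    (by filter_upwards [hcst] with τ hτ using (hφH _ hτ.1 hτ.2).1)] at es
  rw [modelDeriv_of_eventually_const (y := 𝒢.tgt g)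
    (by filter_upwards [hcst] with τ hτ using (hφH _ hτ.1 hτ.2).2.1)] at et
  rw [modelDeriv_congr (F₁ := c)
    (by filter_upwards [hcst] with τ hτ using (hφH _ hτ.1 hτ.2).2.2)] at eφ
  refine ⟨modelDeriv 𝓘(ℝ, ℝ) (𝓡 k) (fun τ ↦ H (c τ)) 0 1, ?_, ?_, ?_⟩
  · exact congrArg (fun L : ℝ →L[ℝ] EuclideanSpace ℝ (Fin m) ↦ L 1) es.symm
  · exact congrArg (fun L : ℝ →L[ℝ] EuclideanSpace ℝ (Fin m) ↦ L 1) et.symm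
  · exact (congrArg (fun L : ℝ →L[ℝ] EuclideanSpace ℝ (Fin k') ↦ L 1) eφ.symm).trans hcw

end LieGroupoidHom

/-! ### Openness of submersions on fibre products -/

section Covering

variable {E₁ H₁ M₁ E₂ H₂ M₂ E H M E' H' N : Type*}
  [NormedAddCommGroup E₁] [NormedSpace ℝ E₁] [FiniteDimensional ℝ E₁]
  [TopologicalSpace H₁] [TopologicalSpace M₁] [ChartedSpace H₁ M₁]
  [NormedAddCommGroup E₂] [NormedSpace ℝ E₂] [FiniteDimensional ℝ E₂]
  [TopologicalSpace H₂] [TopologicalSpace M₂] [ChartedSpace H₂ M₂]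
  [NormedAddCommGroup E] [NormedSpace ℝ E] [FiniteDimensional ℝ E]
  [TopologicalSpace H] [TopologicalSpace M] [ChartedSpace H M]
  [NormedAddCommGroup E'] [NormedSpace ℝ E'] [FiniteDimensional ℝ E']
  [TopologicalSpace H'] [TopologicalSpace N] [ChartedSpace H' N]
  {I₁ : ModelWithCorners ℝ E₁ H₁} [I₁.Boundaryless]
  {I₂ : ModelWithCorners ℝ E₂ H₂} [I₂.Boundaryless]
  {I : ModelWithCorners ℝ E H} [IsManifold I ∞ M]
  {J : ModelWithCorners ℝ E' H'} [J.Boundaryless]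

/-- If `q ∘ pr₁` is a submersion on the fibre product of a submersion `f₁` with `f₂`, it is open. -/
theorem eventually_exists_fiberProduct {f₁ : M₁ → M} {f₂ : M₂ → M} {q : M₁ → N} {x₁ : M₁} {x₂ : M₂}
    (h : f₁ x₁ = f₂ x₂) (hf₁ : ContMDiffAt I₁ I ∞ f₁ x₁) (hf₂ : ContMDiffAt I₂ I ∞ f₂ x₂)
    (hq : ContMDiffAt I₁ J ∞ q x₁) (hs : Function.Surjective (modelDeriv I₁ I f₁ x₁))
    (hex : ∀ n, ∃ v w, modelDeriv I₁ I f₁ x₁ v = modelDeriv I₂ I f₂ x₂ w ∧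
      modelDeriv I₁ J q x₁ v = n) {U : Set M₂} (hU : U ∈ 𝓝 x₂) :
    ∀ᶠ y in 𝓝 (q x₁), ∃ z₁, ∃ z₂ ∈ U, f₁ z₁ = f₂ z₂ ∧ q z₁ = y := by
  obtain ⟨Θ, hΘ, hΘ0, hΘd⟩ := exists_localDifference h hf₁ hf₂
  have hq' : ContMDiffAt (I₁.prod I₂) J ∞ (fun p : M₁ × M₂ ↦ q p.1) (x₁, x₂) :=
    ContMDiffAt.comp (x₁, x₂) hq contMDiffAt_fst
  have hqd : ∀ v w, modelDeriv (I₁.prod I₂) J (fun p : M₁ × M₂ ↦ q p.1) (x₁, x₂) (v, w) =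
      modelDeriv I₁ J q x₁ v := by
    intro v w
    rw [modelDeriv_comp (F := Prod.fst) (y := x₁) rfl (hq.mdifferentiableAt (by simp))
      ((contMDiffAt_fst (n := ∞)).mdifferentiableAt (by simp))]
    exact congrArg (modelDeriv I₁ J q x₁) (congrArg (fun L : E₁ × E₂ →L[ℝ] E₁ ↦ L (v, w))
      (mfderiv_fst (I := I₁) (I' := I₂) (x := (x₁, x₂))))
  have hΞ := hΘ.prodMk hq'
  have hsurj : Function.Surjective (modelDeriv (I₁.prod I₂) (𝓘(ℝ, E).prod J)
      (fun p : M₁ × M₂ ↦ (Θ p, q p.1)) (x₁, x₂)) := by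
    rw [modelDeriv_prodMk (hΘ.mdifferentiableAt (by simp)) (hq'.mdifferentiableAt (by simp))]
    -- A vector `v₀` with `df₁ v₀ = a` produces the component `a`. Adding a tangent vector of the
    -- fibre product then corrects the `N`-component without changing `dΘ`.
    rintro ⟨a, n⟩
    obtain ⟨v₀, hv₀⟩ := hs a
    obtain ⟨v, w, h1, h2⟩ := hex (n - modelDeriv I₁ J q x₁ v₀)
    refine ⟨(v₀ + v, w), Prod.ext ?_ ?_⟩
    · refine (hΘd _ _).trans ?_
      rw [map_add, h1, hv₀, add_sub_cancel_right]
    · refine (hqd _ _).trans ?_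
      rw [map_add, h2, add_sub_cancel]
  have hm := hΞ.map_nhds_eq_of_surjective hsurj
  have hΘx : Θ (x₁, x₂) = 0 := hΘ0.self_of_nhds.2 h
  have hev : ∀ᶠ p in 𝓝 (x₁, x₂), (Θ p = 0 ↔ f₁ p.1 = f₂ p.2) ∧ p.2 ∈ U :=
    hΘ0.and (continuousAt_snd.preimage_mem_nhds hU)
  have him := Filter.image_mem_map (m := fun p : M₁ × M₂ ↦ (Θ p, q p.1)) hev
  rw [hm, hΘx] at him
  -- The image under `(Θ, q ∘ pr₁)` is a neighbourhood of `(0, q x₁)`. Restricting to the slice `Θ =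
  -- 0` selects points of the fibre product.
  have hc : ContinuousAt (fun y : N ↦ ((0 : E), y)) (q x₁) := by fun_prop
  filter_upwards [hc.preimage_mem_nhds him] with y hy
  obtain ⟨p, hp, hpy⟩ := hy
  exact ⟨p.1, p.2, hp.2, hp.1.1 (congrArg Prod.fst hpy), congrArg Prod.snd hpy⟩

end Covering

/-! ### Differential of the anchor -/

namespace LieGroupoid

variable {m k : ℕ} {M G : Type*}
  [TopologicalSpace M] [ChartedSpace (EuclideanSpace ℝ (Fin m)) M]
  [TopologicalSpace G] [ChartedSpace (EuclideanSpace ℝ (Fin k)) G]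
  (𝒢 : LieGroupoid m k M G)

theorem anchor_smooth : ContMDiff (𝓡 k) ((𝓡 m).prod (𝓡 m)) ∞ 𝒢.anchor :=
  𝒢.tgt_smooth.prodMk 𝒢.src_smooth

theorem modelDeriv_anchor (g : G) (w : EuclideanSpace ℝ (Fin k)) :
    modelDeriv (𝓡 k) ((𝓡 m).prod (𝓡 m)) 𝒢.anchor g w = (𝒢.dtgt g w, 𝒢.dsrc g w) :=
  congrArg (fun L : EuclideanSpace ℝ (Fin k) →L[ℝ]
      EuclideanSpace ℝ (Fin m) × EuclideanSpace ℝ (Fin m) ↦ L w)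
    (modelDeriv_prodMk ((𝒢.tgt_contMDiffAt g).mdifferentiableAt (by simp))
      ((𝒢.src_contMDiffAt g).mdifferentiableAt (by simp)))

/-- The unit section carries `ds w` to a vector `u` on which both `ds` and `dt` equal `ds w`. Then
`w - u` is tangent to the source fibre and `dt` sends it to the difference. -/
theorem dtgt_sub_dsrc_mem [IsManifold (𝓡 m) ∞ M] [IsManifold (𝓡 k) ∞ G] (x : M)
    (w : EuclideanSpace ℝ (Fin k)) :
    𝒢.dtgt (𝒢.one x) w - 𝒢.dsrc (𝒢.one x) w ∈ 𝒢.orbitDirections x := by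
  have hone : MDifferentiableAt (𝓡 m) (𝓡 k) 𝒢.one x := 𝒢.one_smooth.mdifferentiableAt (by simp)
  have hs := modelDeriv_comp (y := 𝒢.one x) rfl
    ((𝒢.src_contMDiffAt (𝒢.one x)).mdifferentiableAt (by simp)) hone
  have ht := modelDeriv_comp (y := 𝒢.one x) rfl
    ((𝒢.tgt_contMDiffAt (𝒢.one x)).mdifferentiableAt (by simp)) hone
  have hid : modelDeriv (𝓡 m) (𝓡 m) (fun z : M ↦ z) x = ContinuousLinearMap.id ℝ _ := mfderiv_id
  rw [funext 𝒢.src_one, hid] at hs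
  rw [funext 𝒢.tgt_one, hid] at ht
  set v := 𝒢.dsrc (𝒢.one x) w with hv
  set u := modelDeriv (𝓡 m) (𝓡 k) 𝒢.one x v with hu
  have hs' : 𝒢.dsrc (𝒢.one x) u = v :=
    congrArg (fun L : EuclideanSpace ℝ (Fin m) →L[ℝ] EuclideanSpace ℝ (Fin m) ↦ L v) hs.symm
  have ht' : 𝒢.dtgt (𝒢.one x) u = v :=
    congrArg (fun L : EuclideanSpace ℝ (Fin m) →L[ℝ] EuclideanSpace ℝ (Fin m) ↦ L v) ht.symm
  refine ⟨w - u, ?_, ?_⟩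
  · exact (map_sub (𝒢.dsrc (𝒢.one x)) w u).trans (sub_eq_zero.2 hs'.symm)
  · exact (map_sub (𝒢.dtgt (𝒢.one x)) w u).trans (congrArg (𝒢.dtgt (𝒢.one x) w - ·) ht')

end LieGroupoid

/-! ### The differential of a groupoid map, and elementary forms of the two conditions -/

namespace LieGroupoidHom

variable {m k m' k' : ℕ} {M G M' G' : Type*}
  [TopologicalSpace M] [ChartedSpace (EuclideanSpace ℝ (Fin m)) M]
  [TopologicalSpace G] [ChartedSpace (EuclideanSpace ℝ (Fin k)) G]
  [TopologicalSpace M'] [ChartedSpace (EuclideanSpace ℝ (Fin m')) M']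
  [TopologicalSpace G'] [ChartedSpace (EuclideanSpace ℝ (Fin k')) G']
  {𝒢 : LieGroupoid m k M G} {𝒢' : LieGroupoid m' k' M' G'} (φ : LieGroupoidHom 𝒢 𝒢')

theorem dsrc_modelDeriv (g : G) (w : EuclideanSpace ℝ (Fin k)) :
    𝒢'.dsrc (φ.ar g) (modelDeriv (𝓡 k) (𝓡 k') φ.ar g w) =
      modelDeriv (𝓡 m) (𝓡 m') φ.ob (𝒢.src g) (𝒢.dsrc g w) :=
  φ.dsrc_ar g w

theorem dtgt_modelDeriv (g : G) (w : EuclideanSpace ℝ (Fin k)) :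
    𝒢'.dtgt (φ.ar g) (modelDeriv (𝓡 k) (𝓡 k') φ.ar g w) =
      modelDeriv (𝓡 m) (𝓡 m') φ.ob (𝒢.tgt g) (𝒢.dtgt g w) :=
  φ.dtgt_ar g w

theorem modelDeriv_prodMap_ob (x y : M) (v w : EuclideanSpace ℝ (Fin m)) :
    modelDeriv ((𝓡 m).prod (𝓡 m)) ((𝓡 m').prod (𝓡 m')) (Prod.map φ.ob φ.ob) (x, y) (v, w) =
      (modelDeriv (𝓡 m) (𝓡 m') φ.ob x v, modelDeriv (𝓡 m) (𝓡 m') φ.ob y w) :=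
  congrArg (fun L : EuclideanSpace ℝ (Fin m) × EuclideanSpace ℝ (Fin m) →L[ℝ]
      EuclideanSpace ℝ (Fin m') × EuclideanSpace ℝ (Fin m') ↦ L (v, w))
    (modelDeriv_prodMap (p := (x, y)) (φ.ob_smooth.mdifferentiableAt (by simp))
      (φ.ob_smooth.mdifferentiableAt (by simp)))

theorem anchor_ar (g : G) : Prod.map φ.ob φ.ob (𝒢.anchor g) = 𝒢'.anchor (φ.ar g) :=
  Prod.ext (φ.tgt_ar g).symm (φ.src_ar g).symm

theorem continuous_orbitMap : Continuous φ.orbitMap :=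
  φ.ob_smooth.continuous.quotient_map' _

variable {φ}

theorem normalMap_injective_iff {x : M} : Function.Injective (φ.normalMap x) ↔
    ∀ v, modelDeriv (𝓡 m) (𝓡 m') φ.ob x v ∈ 𝒢'.orbitDirections (φ.ob x) →
      v ∈ 𝒢.orbitDirections x := by
  rw [injective_iff_map_eq_zero]
  constructor
  · intro h v hv
    exact (Submodule.Quotient.mk_eq_zero _).1
      (h ((𝒢.orbitTangent x).mkQ v) ((Submodule.Quotient.mk_eq_zero _).2 hv))
  · intro h n hn
    obtain ⟨v, rfl⟩ := Submodule.mkQ_surjective _ n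
    exact (Submodule.Quotient.mk_eq_zero _).2 (h v ((Submodule.Quotient.mk_eq_zero _).1 hn))

theorem normalMap_surjective_iff {x : M} : Function.Surjective (φ.normalMap x) ↔
    ∀ v', ∃ v, v' - modelDeriv (𝓡 m) (𝓡 m') φ.ob x v ∈ 𝒢'.orbitDirections (φ.ob x) := by
  constructor
  · intro h v'
    obtain ⟨n, hn⟩ := h ((𝒢'.orbitTangent (φ.ob x)).mkQ v')
    obtain ⟨v, rfl⟩ := Submodule.mkQ_surjective _ n
    exact ⟨v, (Submodule.Quotient.eq _).1 hn.symm⟩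
  · intro h n
    obtain ⟨v', rfl⟩ := Submodule.mkQ_surjective _ n
    obtain ⟨v, hv⟩ := h v'
    exact ⟨(𝒢.orbitTangent x).mkQ v, ((Submodule.Quotient.eq _).2 hv).symm⟩

theorem IsEssentiallySurjective.exists_modelDeriv (h : φ.IsEssentiallySurjective) {a : G'} {x : M}
    (hax : 𝒢'.src a = φ.ob x) (v : EuclideanSpace ℝ (Fin m')) :
    ∃ (u : EuclideanSpace ℝ (Fin k')) (w : EuclideanSpace ℝ (Fin m)),
      𝒢'.dsrc a u = modelDeriv (𝓡 m) (𝓡 m') φ.ob x w ∧ 𝒢'.dtgt a u = v := by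
  obtain ⟨⟨u, w⟩, h1, h2⟩ := h.submersion (a, x) hax (Set.mem_univ v)
  exact ⟨u, w, h1, h2⟩

theorem IsFullyFaithful.exists_ar_eq (h : IsFullyFaithful.{w} φ) {x y : M} {a : G'}
    (hs : 𝒢'.src a = φ.ob x) (ht : 𝒢'.tgt a = φ.ob y) :
    ∃ g, 𝒢.src g = x ∧ 𝒢.tgt g = y ∧ φ.ar g = a := by
  obtain ⟨g, hg⟩ := h.topological.surjective
    ⟨((y, x), a), (Prod.ext ht.symm hs.symm : (φ.ob y, φ.ob x) = (𝒢'.tgt a, 𝒢'.src a))⟩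
  have h1 : (𝒢.anchor g, φ.ar g) = ((y, x), a) := congrArg Subtype.val hg
  exact ⟨g, congrArg (fun p ↦ p.1.2) h1, congrArg (fun p ↦ p.1.1) h1, congrArg Prod.snd h1⟩

theorem IsFullyFaithful.ar_injective (h : IsFullyFaithful.{w} φ) {g l : G}
    (hs : 𝒢.src g = 𝒢.src l) (ht : 𝒢.tgt g = 𝒢.tgt l) (ha : φ.ar g = φ.ar l) : g = l :=
  h.topological.injective (Subtype.ext (Prod.ext (Prod.ext ht hs) ha))

theorem IsFullyFaithful.bijOn_isotropySet (h : IsFullyFaithful.{w} φ) (x : M) :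
    Set.BijOn φ.ar (𝒢.isotropySet x) (𝒢'.isotropySet (φ.ob x)) := by
  refine ⟨?_, ?_, ?_⟩
  · rintro g ⟨h1, h2⟩
    exact ⟨by rw [φ.src_ar, h1], by rw [φ.tgt_ar, h2]⟩
  · rintro g ⟨h1, h2⟩ l ⟨h3, h4⟩ hgl
    exact h.ar_injective (h1.trans h3.symm) (h2.trans h4.symm) hgl
  · rintro a ⟨h1, h2⟩
    obtain ⟨g, h3, h4, rfl⟩ := h.exists_ar_eq h1 h2
    exact ⟨g, ⟨h3, h4⟩, rfl⟩

theorem isotropyMap_bijective_of_bijOn {x : M}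
    (h : Set.BijOn φ.ar (𝒢.isotropySet x) (𝒢'.isotropySet (φ.ob x))) :
    Function.Bijective (φ.isotropyMap x) := by
  constructor
  · rintro ⟨g, hg⟩ ⟨l, hl⟩ hgl
    exact Subtype.ext (h.injOn hg hl (congrArg Subtype.val hgl))
  · rintro ⟨a, ha⟩
    obtain ⟨g, hg, rfl⟩ := h.surjOn ha
    exact ⟨⟨g, hg⟩, rfl⟩

/-! ### From weak equivalences to orbit spaces and normal representations -/

variable [IsManifold (𝓡 m) ∞ M] [IsManifold (𝓡 k) ∞ G]
  [IsManifold (𝓡 m') ∞ M'] [IsManifold (𝓡 k') ∞ G']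

omit [IsManifold (𝓡 m) ∞ M] [IsManifold (𝓡 m') ∞ M'] [IsManifold (𝓡 k') ∞ G'] in
-- The inverse on isotropy sends `a` to the arrow lying over `((x, x), a)`. It is continuous by the
-- topological pullback, and smooth because locally it is `a ↦ r ((x, x), a)` for a smooth
-- retraction `r` of `(anchor, φ)`.
theorem IsFullyFaithful.restrictsToDiffeo (h : IsFullyFaithful.{w} φ) (x : M) :
    RestrictsToDiffeo (𝓡 k) (𝓡 k') φ.ar (𝒢.isotropySet x) (𝒢'.isotropySet (φ.ob x)) := by
  have hbij := h.bijOn_isotropySet x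
  have : Nonempty G := ⟨𝒢.one x⟩
  set T := 𝒢'.isotropySet (φ.ob x)
  set f : G' → G := Function.invFunOn φ.ar (𝒢.isotropySet x)
  have hmaps : Set.MapsTo f T (𝒢.isotropySet x) := hbij.surjOn.mapsTo_invFunOn
  have hinv : Set.InvOn f φ.ar (𝒢.isotropySet x) T := hbij.invOn_invFunOn
  refine ⟨hbij, φ.ar_smooth.contMDiffOn, f, hinv, hmaps, ?_⟩
  have hmem : ∀ a : T, ((x, x), (a : G')) ∈ fiberProduct (Prod.map φ.ob φ.ob) 𝒢'.anchor :=
    fun a ↦ Prod.ext a.2.2.symm a.2.1.symm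
  have hF : ∀ a ∈ T, (𝒢.anchor (f a), φ.ar (f a)) = ((x, x), a) := fun a ha ↦
    Prod.ext (Prod.ext (hmaps ha).2 (hmaps ha).1) (hinv.2 ha)
  have hcont : ContinuousOn f T := by
    rw [continuousOn_iff_continuous_domRestrict]
    have hc : Continuous (fun a : T ↦
        h.topological.homeomorph.symm ⟨((x, x), (a : G')), hmem a⟩) :=
      h.topological.homeomorph.symm.continuous.comp
        ((continuous_const.prodMk continuous_subtype_val).subtype_mk _)
    convert! hc using 1
    funext a
    rw [Homeomorph.eq_symm_apply]
    exact Subtype.ext (hF a a.2)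
  intro a ha
  obtain ⟨r, hr, hrp⟩ := exists_leftInverse_prodMk (𝒢.anchor_smooth (f a)) (φ.ar_smooth (f a))
    (fun u h1 h2 ↦ IsGoodPullback.eq_zero_of_modelDeriv h h1 h2)
  rw [hF a ha] at hr
  have h1 : ContMDiffAt (𝓡 k') (𝓡 k) ∞ (fun b : G' ↦ r ((x, x), b)) a :=
    ContMDiffAt.comp a hr (contMDiffAt_const.prodMk contMDiffAt_id)
  refine h1.contMDiffWithinAt.congr_of_eventuallyEq ?_ ?_
  · filter_upwards [(hcont a ha).eventually hrp, self_mem_nhdsWithin] with b hb hbT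
    rw [← hF b hbT, hb]
  · rw [← hF a ha, hrp.self_of_nhds]

/-- True for every groupoid map: if `w` represents the action of `g` on `[ds w]`, then `dφ w`
represents the action of `φ(g)` on the image, because `dφ` commutes with `ds` and `dt`. -/
theorem normalMap_equivariant {x : M} (g : 𝒢.Isotropy x) (n : 𝒢.NormalSpace x) :
    φ.normalMap x (𝒢.normalRep x g n) =
      𝒢'.normalRep (φ.ob x) (φ.isotropyMap x g) (φ.normalMap x n) := by
  obtain ⟨g, hs, ht⟩ := g
  obtain ⟨w, rfl⟩ := 𝒢.srcNormal_surjective g hs n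
  set g' := φ.isotropyMap x ⟨g, hs, ht⟩ with hg'
  have h1 : φ.normalMap x (𝒢.srcNormal g hs w) =
      𝒢'.srcNormal g'.1 g'.2.1 (modelDeriv (𝓡 k) (𝓡 k') φ.ar g w) := by
    have h := φ.dsrc_modelDeriv g w
    rw [hs] at h
    exact congrArg (𝒢'.orbitTangent (φ.ob x)).mkQ h.symm
  have h2 : φ.normalMap x (𝒢.tgtNormal g ht w) =
      𝒢'.tgtNormal g'.1 g'.2.2 (modelDeriv (𝓡 k) (𝓡 k') φ.ar g w) := by
    have h := φ.dtgt_modelDeriv g w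
    rw [ht] at h
    exact congrArg (𝒢'.orbitTangent (φ.ob x)).mkQ h.symm
  change φ.normalMap x (𝒢.normalAction g hs ht (𝒢.srcNormal g hs w)) =
    𝒢'.normalAction g'.1 g'.2.1 g'.2.2 (φ.normalMap x (𝒢.srcNormal g hs w))
  rw [𝒢.normalAction_srcNormal, h1, 𝒢'.normalAction_srcNormal, h2]

omit [IsManifold (𝓡 m) ∞ M] [IsManifold (𝓡 k) ∞ G] in
theorem IsWeakEquivalence.normalMap_bijective (h : IsWeakEquivalence.{w} φ) (x : M) :
    Function.Bijective (φ.normalMap x) := by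
  constructor
  · rw [normalMap_injective_iff]
    rintro v ⟨u, hu, huv⟩
    rw [← φ.ar_one] at hu huv
    have hu' : 𝒢'.dsrc (φ.ar (𝒢.one x)) u = 0 := hu
    have huv' : 𝒢'.dtgt (φ.ar (𝒢.one x)) u = modelDeriv (𝓡 m) (𝓡 m') φ.ob x v := huv
    have hx : 𝒢.anchor (𝒢.one x) = (x, x) := Prod.ext (𝒢.tgt_one x) (𝒢.src_one x)
    -- The anchor lists the target first: `(v, 0)` asks for `z` with `dt z = v` and `ds z = 0`,
    -- which exhibits `v` as tangent to the orbit.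
    obtain ⟨z, hz, -⟩ := IsGoodPullback.exists_modelDeriv h.1 (p := 𝒢.one x) (v := (v, 0)) (w := u)
      (by rw [hx, φ.modelDeriv_prodMap_ob, 𝒢'.modelDeriv_anchor, hu', huv', map_zero])
    rw [𝒢.modelDeriv_anchor] at hz
    exact ⟨z, congrArg Prod.snd hz, congrArg Prod.fst hz⟩
  · rw [normalMap_surjective_iff]
    intro v'
    -- At the unit, `v' = dt u` and `dφ v = ds u`, so the two differ by an orbit direction.
    obtain ⟨u, v, h1, rfl⟩ := h.2.exists_modelDeriv (𝒢'.src_one (φ.ob x)) v'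
    exact ⟨v, h1 ▸ 𝒢'.dtgt_sub_dsrc_mem (φ.ob x) u⟩

omit [IsManifold (𝓡 m) ∞ M] [IsManifold (𝓡 k) ∞ G] in
-- The saturation in `M'` of the image of an open set of `M` is obtained by applying `t ∘ pr₁` to an
-- open part of `G' ×_{M'} M`, and that submersion is open.
theorem IsEssentiallySurjective.isOpenMap_orbitMap (h : φ.IsEssentiallySurjective) :
    IsOpenMap φ.orbitMap := by
  intro U hU
  rw [isOpen_coinduced, isOpen_iff_mem_nhds]
  rintro y ⟨o, ho, hoy⟩
  obtain ⟨x, rfl⟩ := Quotient.exists_rep o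
  obtain ⟨a, ha, rfl⟩ := Quotient.exact hoy
  have hV : {z : M | (Quotient.mk 𝒢.orbitRel z) ∈ U} ∈ 𝓝 x :=
    (hU.preimage continuous_quotient_mk').mem_nhds ho
  filter_upwards [eventually_exists_fiberProduct ha (𝒢'.src_contMDiffAt a) (φ.ob_smooth x)
    (𝒢'.tgt_contMDiffAt a) (𝒢'.dsrc_surjective a) (fun n ↦ h.exists_modelDeriv ha n) hV]
    with y ⟨b, z, hz, hbz, hby⟩
  exact ⟨_, hz, Quotient.sound ⟨b, hbz, hby⟩⟩

omit [IsManifold (𝓡 m) ∞ M] [IsManifold (𝓡 k) ∞ G] in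
theorem IsWeakEquivalence.isHomeomorph_orbitMap (h : IsWeakEquivalence.{w} φ) :
    IsHomeomorph φ.orbitMap := by
  refine ⟨φ.continuous_orbitMap, h.2.isOpenMap_orbitMap, ?_, ?_⟩
  · intro o p hop
    obtain ⟨x, rfl⟩ := Quotient.exists_rep o
    obtain ⟨y, rfl⟩ := Quotient.exists_rep p
    obtain ⟨a, ha, hb⟩ := Quotient.exact hop
    obtain ⟨g, hg, hg', -⟩ := h.1.exists_ar_eq ha hb
    exact Quotient.sound ⟨g, hg, hg'⟩
  · intro o
    obtain ⟨y, rfl⟩ := Quotient.exists_rep o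
    obtain ⟨⟨a, x⟩, hax, rfl⟩ := h.2.surjective (Set.mem_univ y)
    exact ⟨Quotient.mk _ x, Quotient.sound ⟨a, hax, rfl⟩⟩

theorem IsWeakEquivalence.isNormalRepIsoAt (h : IsWeakEquivalence.{w} φ) (x : M) :
    φ.IsNormalRepIsoAt x where
  isotropy_bijective := isotropyMap_bijective_of_bijOn (h.1.bijOn_isotropySet x)
  isotropy_diffeo := h.1.restrictsToDiffeo x
  normal_bijective := h.normalMap_bijective x
  equivariant := normalMap_equivariant

/-! ### From orbit spaces and normal representations to weak equivalences -/

omit [IsManifold (𝓡 m) ∞ M] [IsManifold (𝓡 k) ∞ G] in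
theorem isEssentiallySurjective_of_orbitMap (ho : Function.Surjective φ.orbitMap)
    (hn : ∀ x, Function.Surjective (φ.normalMap x)) : φ.IsEssentiallySurjective where
  surjective := by
    intro y _
    obtain ⟨o, hoy⟩ := ho (Quotient.mk _ y)
    obtain ⟨x, rfl⟩ := Quotient.exists_rep o
    obtain ⟨a, ha, rfl⟩ := Quotient.exact hoy
    exact ⟨(a, x), ha, rfl⟩
  submersion := by
    rintro ⟨a, x⟩ hax v _
    have hax' : 𝒢'.src a = φ.ob x := hax
    obtain ⟨u, hu⟩ := 𝒢'.dtgt_surjective a v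
    -- Surjectivity on normal spaces places `ds u` in the image of `dφ` up to an orbit direction.
    -- The vector `z` removes that direction at the source without affecting the target.
    obtain ⟨w, hw⟩ := normalMap_surjective_iff.1 (hn x) (𝒢'.dsrc a u)
    obtain ⟨z, hz1, hz2⟩ := 𝒢'.exists_lift_orbitTangent hax' hw
    refine ⟨(u - z, w), ?_, ?_⟩
    · change 𝒢'.dsrc a (u - z) = modelDeriv (𝓡 m) (𝓡 m') φ.ob x w
      rw [map_sub, hz1, sub_sub_cancel]
    · change 𝒢'.dtgt a (u - z) = v
      rw [map_sub, hz2, sub_zero, hu]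

omit [IsManifold (𝓡 m) ∞ M] [IsManifold (𝓡 k) ∞ G]
  [IsManifold (𝓡 m') ∞ M'] [IsManifold (𝓡 k') ∞ G'] in
-- When nonempty, the arrows between two objects form a torsor under isotropy, so bijectivity on
-- isotropy groups propagates to them. Injectivity on orbits supplies an arrow in `G` whenever `G'`
-- has one between the images.
theorem bijOn_fiberProduct (ho : Function.Injective φ.orbitMap)
    (hi : ∀ x, Set.BijOn φ.ar (𝒢.isotropySet x) (𝒢'.isotropySet (φ.ob x))) :
    Set.BijOn (fun g ↦ (𝒢.anchor g, φ.ar g)) Set.univ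
      (fiberProduct (Prod.map φ.ob φ.ob) 𝒢'.anchor) := by
  refine ⟨fun g _ ↦ φ.anchor_ar g, ?_, ?_⟩
  · intro g _ l _ hgl
    have ht : 𝒢.tgt g = 𝒢.tgt l := congrArg (fun p ↦ p.1.1) hgl
    have hs : 𝒢.src g = 𝒢.src l := congrArg (fun p ↦ p.1.2) hgl
    have ha : φ.ar g = φ.ar l := congrArg Prod.snd hgl
    have hc : 𝒢.src (𝒢.inv g) = 𝒢.tgt l := (𝒢.src_inv g).trans ht
    have h1 : 𝒢.mul (𝒢.inv g) l ∈ 𝒢.isotropySet (𝒢.src g) :=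
      ⟨(𝒢.src_mul _ _ hc).trans hs.symm, (𝒢.tgt_mul _ _ hc).trans (𝒢.tgt_inv g)⟩
    have h2 : 𝒢.mul (𝒢.inv g) l = 𝒢.one (𝒢.src g) := by
      apply (hi _).injOn h1 ⟨𝒢.src_one _, 𝒢.tgt_one _⟩
      rw [φ.ar_mul _ _ hc, ← ha, ← φ.ar_mul _ _ (𝒢.src_inv g), 𝒢.inv_mul]
    rw [← 𝒢.mul_inv_cancel_left ht, h2, 𝒢.mul_one]
  · rintro ⟨⟨y, x⟩, a⟩ h
    have ht : φ.ob y = 𝒢'.tgt a := congrArg Prod.fst h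
    have hs : φ.ob x = 𝒢'.src a := congrArg Prod.snd h
    have hxy : φ.orbitMap (Quotient.mk _ x) = φ.orbitMap (Quotient.mk _ y) :=
      Quotient.sound ⟨a, hs.symm, ht.symm⟩
    obtain ⟨g, rfl, rfl⟩ := Quotient.exact (ho hxy)
    have hc : 𝒢'.src (𝒢'.inv (φ.ar g)) = 𝒢'.tgt a := by rw [𝒢'.src_inv, φ.tgt_ar, ht]
    obtain ⟨l, hl, hla⟩ := (hi (𝒢.src g)).surjOn
      (show 𝒢'.mul (𝒢'.inv (φ.ar g)) a ∈ 𝒢'.isotropySet (φ.ob (𝒢.src g)) from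
        ⟨(𝒢'.src_mul _ _ hc).trans hs.symm, by rw [𝒢'.tgt_mul _ _ hc, 𝒢'.tgt_inv, φ.src_ar]⟩)
    refine ⟨𝒢.mul g l, Set.mem_univ _, ?_⟩
    refine Prod.ext (Prod.ext (𝒢.tgt_mul _ _ hl.2.symm) ((𝒢.src_mul _ _ hl.2.symm).trans hl.1)) ?_
    change φ.ar (𝒢.mul g l) = a
    rw [φ.ar_mul _ _ hl.2.symm, hla, 𝒢'.mul_inv_cancel_left]
    rw [φ.tgt_ar, ht]

/-- Exactness of the tangent sequence: a vector of `T G'` and vectors of `T M` at source and target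
with matching images come from `T G`. -/
theorem exists_tangent_lift
    {g : G} (hi : RestrictsToDiffeo (𝓡 k) (𝓡 k') φ.ar (𝒢.isotropySet (𝒢.src g))
      (𝒢'.isotropySet (φ.ob (𝒢.src g))))
    (hn : Function.Injective (φ.normalMap (𝒢.tgt g))) {a b : EuclideanSpace ℝ (Fin m)}
    {u : EuclideanSpace ℝ (Fin k')}
    (ha : modelDeriv (𝓡 m) (𝓡 m') φ.ob (𝒢.tgt g) a = 𝒢'.dtgt (φ.ar g) u)
    (hb : modelDeriv (𝓡 m) (𝓡 m') φ.ob (𝒢.src g) b = 𝒢'.dsrc (φ.ar g) u) :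
    ∃ w, 𝒢.dtgt g w = a ∧ 𝒢.dsrc g w = b ∧ modelDeriv (𝓡 k) (𝓡 k') φ.ar g w = u := by
  -- The lift is a sum of three terms: `w₀` matches the source, `w₁` in `ker ds` corrects the target
  -- by injectivity on normal spaces, and `w₂` in `ker ds ∩ ker dt` corrects the component in `T G'`
  -- by the isotropy diffeomorphism.
  obtain ⟨w₀, hw₀⟩ := 𝒢.dsrc_surjective g b
  have h1 : 𝒢'.dsrc (φ.ar g) (u - modelDeriv (𝓡 k) (𝓡 k') φ.ar g w₀) = 0 := by
    rw [map_sub, φ.dsrc_modelDeriv, hw₀, hb, sub_self]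
  have h2 := 𝒢'.dtgt_mem_orbitTangent (φ.tgt_ar g) h1
  rw [map_sub, φ.dtgt_modelDeriv, ← ha, ← map_sub] at h2
  obtain ⟨w₁, hw₁, hw₁'⟩ := 𝒢.exists_lift_orbitTangent_tgt (normalMap_injective_iff.1 hn _ h2)
  have hs : 𝒢.dsrc g (w₀ + w₁) = b := by rw [map_add, hw₀, hw₁, add_zero]
  have ht : 𝒢.dtgt g (w₀ + w₁) = a := by rw [map_add, hw₁', add_sub_cancel]
  obtain ⟨w₂, h3, h4, h5⟩ := φ.exists_of_restrictsToDiffeo hi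
    (u := u - modelDeriv (𝓡 k) (𝓡 k') φ.ar g (w₀ + w₁))
    (by rw [map_sub, φ.dsrc_modelDeriv, hs, hb, sub_self])
    (by rw [map_sub, φ.dtgt_modelDeriv, ht, ha, sub_self])
  refine ⟨w₀ + w₁ + w₂, ?_, ?_, ?_⟩
  · rw [map_add, ht, h4, add_zero]
  · rw [map_add, hs, h3, add_zero]
  · rw [map_add, h5, add_sub_cancel]

theorem isFullyFaithful_of_orbitMap (ho : Function.Injective φ.orbitMap)
    (hn : ∀ x, φ.IsNormalRepIsoAt x) : IsFullyFaithful.{w} φ := by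
  refine isGoodPullback_of_bijective 𝒢.anchor_smooth φ.ar_smooth
    (φ.ob_smooth.prodMap φ.ob_smooth) 𝒢'.anchor_smooth φ.anchor_ar
    (bijOn_fiberProduct ho fun x ↦ (hn x).isotropy_diffeo.1) ?_ ?_
  · intro g w h1 h2
    rw [𝒢.modelDeriv_anchor] at h1
    exact φ.eq_zero_of_restrictsToDiffeo (hn _).isotropy_diffeo (congrArg Prod.snd h1)
      (congrArg Prod.fst h1) h2
  · rintro g ⟨a, b⟩ u h
    have h' : (modelDeriv (𝓡 m) (𝓡 m') φ.ob (𝒢.tgt g) a,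
        modelDeriv (𝓡 m) (𝓡 m') φ.ob (𝒢.src g) b) =
        (𝒢'.dtgt (φ.ar g) u, 𝒢'.dsrc (φ.ar g) u) :=
      (φ.modelDeriv_prodMap_ob _ _ _ _).symm.trans (h.trans (𝒢'.modelDeriv_anchor _ _))
    obtain ⟨w, h1, h2, h3⟩ := exists_tangent_lift (hn _).isotropy_diffeo
      (hn _).normal_bijective.1 (congrArg Prod.fst h') (congrArg Prod.snd h')
    exact ⟨w, (𝒢.modelDeriv_anchor g w).trans (Prod.ext h1 h2), h3⟩

end LieGroupoidHom

/-- A map of Lie groupoids is a weak equivalence if and only if it induces a homeomorphism of orbit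
spaces and isomorphisms between the normal representations at all points. -/
theorem theorem4p1 {m k m' k' : ℕ}
    {M : Type*} [TopologicalSpace M] [ChartedSpace (EuclideanSpace ℝ (Fin m)) M]
    [IsManifold (𝓡 m) ∞ M] [T2Space M] [SecondCountableTopology M]
    {G : Type*} [TopologicalSpace G] [ChartedSpace (EuclideanSpace ℝ (Fin k)) G]
    [IsManifold (𝓡 k) ∞ G] [T2Space G] [SecondCountableTopology G]
    {M' : Type*} [TopologicalSpace M'] [ChartedSpace (EuclideanSpace ℝ (Fin m')) M']
    [IsManifold (𝓡 m') ∞ M'] [T2Space M'] [SecondCountableTopology M']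
    {G' : Type*} [TopologicalSpace G'] [ChartedSpace (EuclideanSpace ℝ (Fin k')) G']
    [IsManifold (𝓡 k') ∞ G'] [T2Space G'] [SecondCountableTopology G']
    (𝒢 : LieGroupoid m k M G) (𝒢' : LieGroupoid m' k' M' G') (φ : LieGroupoidHom 𝒢 𝒢') :
    LieGroupoidHom.IsWeakEquivalence.{w} φ ↔
      IsHomeomorph φ.orbitMap ∧ ∀ x : M, φ.IsNormalRepIsoAt x := by
  constructor
  · intro h
    exact ⟨h.isHomeomorph_orbitMap, h.isNormalRepIsoAt⟩
  · rintro ⟨ho, hn⟩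
    exact ⟨LieGroupoidHom.isFullyFaithful_of_orbitMap ho.injective hn,
      LieGroupoidHom.isEssentiallySurjective_of_orbitMap ho.surjective
        fun x ↦ (hn x).normal_bijective.2⟩
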